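/- Let $(X_0,X_1)$ be a compatible couple, that is, two Banach spaces continuously embedded in a common Hausdorff topological vector space, and let $1\le q<\infty$, $1/q+1/q'=1$. Write $\|f\|_{X_0+X_1}=\inf\{\|f_0\|_{X_0}+\|f_1\|_{X_1}: f=f_0+f_1\}$ and $\|f\|_{X_0\cap X_1}=\max\{\|f\|_{X_0},\|f\|_{X_1}\}$ and, for $t>0$, $$K(f,t)=\inf\{\|f_0\|_{X_0}+t\|f_1\|_{X_1}: f=f_0+f_1,\ f_0\in X_0,\ f_1\in X_1\}\quad (f\in X_0+X_1),$$ $$J(f,t)=\max\{\|f\|_{X_0},\,t\|f\|_{X_1}\}\quad (f\in X_0\cap X_1).$$ For a positive measurable function $v$ on $(0,\infty)$, let $(X_0,X_1)_{0,q,v;K}$ be the space of all $f\in X_0+X_1$ with $$\|f\|_{0,q,v;K}=\Big(\int_0^\infty \big(t^{-1/q}v(t)K(f,t)\big)^q\,dt\Big)^{1/q}<\infty,$$ and let $(X_0,X_1)_{0,q,v;J}$ be the space of all $f\in X_0+X_1$ with $$\|f\|_{0,q,v;J}=\inf_u\Big(\int_0^\infty \big(t^{-1/q}v(t)J(u(t),t)\big)^q\,dt\Big)^{1/q}<\infty,$$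 the infimum being over all strongly measurable $u:(0,\infty)\to X_0\cap X_1$ with $f=\int_0^\infty u(s)\,\frac{ds}{s}$ (Bochner integral in $X_0+X_1$; $\inf\emptyset=\infty$). For two such spaces $Y,Z\subset X_0+X_1$, the sum $Y+Z$ carries the norm $\inf\{\|g\|_Y+\|h\|_Z: f=g+h,\ g\in Y,\ h\in Z\}$. Two non-negative functions $f,g$ are equivalent, $f\approx g$, on a set if $c\,g\le f\le C\,g$ there with constants $c,C>0$. A function $b:(0,\infty)\to(0,\infty)$ is slowly varying, $b\in SV(0,\infty)$, if it is Lebesgue measurable and, for each $\varepsilon>0$, $t^{\varepsilon}b(t)$ is equivalent on $(0,\infty)$ to a non-decreasing function and $t^{-\varepsilon}b(t)$ to a non-increasing function. Let $b\in SV(0,\infty)$ satisfy $\int_0^\infty t^{-1}b^q(t)\,dt<\infty$. Let $\beta\in SV(0,\infty)$ satisfy $\int_x^\infty t^{-1}\beta^q(t)\,dt<\infty$ for all $x>0$ and $\int_0^\infty t^{-1}\beta^q(t)\,dt=\infty$. Let $B\in SV(0,\infty)$ be such that $B(x)=b(x)$ for $x\ge 1$ and $B\approx\beta$ on $(0,1)$,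 and put $$A(x)=B^{-q/q'}(x)\int_x^\infty t^{-1}B^q(t)\,dt\qquad\text{for all } x>0$$ (with $q/q'=q-1$, so that the first factor is $1$ if $q=1$). Then $$(X_0,X_1)_{0,q,b;K}=X_0+(X_0,X_1)_{0,q,B;K}=X_0+(X_0,X_1)_{0,q,A;J},$$ where equality means that the spaces coincide as sets and that their norms are equivalent. -/

import Mathlib

open MeasureTheory Set
open scoped ENNReal NNReal

/-- `f ≈ g` on `s`: two-sided estimates with positive constants. -/
def EquivalentOn (s : Set ℝ) (f g : ℝ → ℝ) : Prop :=
  ∃ c C : ℝ, 0 < c ∧ 0 < C ∧ ∀ t ∈ s, c * g t ≤ f t ∧ f t ≤ C * g t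

/-- The class `SV(0,∞)` of slowly varying functions. Only the values on `(0,∞)` matter. A real
function is Lebesgue measurable on `(0,∞)` exactly when it is `AEMeasurable` there. -/
structure IsSlowlyVarying (b : ℝ → ℝ) : Prop where
  pos : ∀ t, 0 < t → 0 < b t
  measurable : AEMeasurable b (volume.restrict (Ioi 0))
  incr : ∀ ε : ℝ, 0 < ε → ∃ g : ℝ → ℝ, MonotoneOn g (Ioi 0) ∧
    EquivalentOn (Ioi 0) (fun t => t ^ ε * b t) g
  decr : ∀ ε : ℝ, 0 < ε → ∃ g : ℝ → ℝ, AntitoneOn g (Ioi 0) ∧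
    EquivalentOn (Ioi 0) (fun t => t ^ (-ε) * b t) g

/-- A compatible couple: two normed spaces (Banach spaces in the applications) continuously
embedded in a Hausdorff topological vector space `𝒳`. Scalars are real; a couple of complex
spaces is a couple of real spaces, and none of the notions below involves the scalars. -/
structure CompatibleCouple (X₀ X₁ 𝒳 : Type*)
    [NormedAddCommGroup X₀] [NormedSpace ℝ X₀] [NormedAddCommGroup X₁] [NormedSpace ℝ X₁]
    [AddCommGroup 𝒳] [Module ℝ 𝒳] [TopologicalSpace 𝒳] [IsTopologicalAddGroup 𝒳]
    [ContinuousSMul ℝ 𝒳] [T2Space 𝒳] where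
  incl₀ : X₀ →L[ℝ] 𝒳
  incl₁ : X₁ →L[ℝ] 𝒳
  injective₀ : Function.Injective incl₀
  injective₁ : Function.Injective incl₁

namespace CompatibleCouple

variable {X₀ X₁ 𝒳 : Type*}
  [NormedAddCommGroup X₀] [NormedSpace ℝ X₀] [NormedAddCommGroup X₁] [NormedSpace ℝ X₁]
  [AddCommGroup 𝒳] [Module ℝ 𝒳] [TopologicalSpace 𝒳] [IsTopologicalAddGroup 𝒳]
  [ContinuousSMul ℝ 𝒳] [T2Space 𝒳]

/-- `(x₀, x₁) ↦ x₀ + x₁ ∈ 𝒳`, on `X₀ × X₁` with the norm `‖x₀‖ + ‖x₁‖`. -/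
noncomputable def addMap (C : CompatibleCouple X₀ X₁ 𝒳) : WithLp 1 (X₀ × X₁) →L[ℝ] 𝒳 :=
  (C.incl₀.coprod C.incl₁).comp (WithLp.prodContinuousLinearEquiv 1 ℝ X₀ X₁).toContinuousLinearMap

/-- The pairs that represent `0`. -/
noncomputable def addKer (C : CompatibleCouple X₀ X₁ 𝒳) : Submodule ℝ (WithLp 1 (X₀ × X₁)) :=
  LinearMap.ker C.addMap.toLinearMap

instance isClosed_addKer (C : CompatibleCouple X₀ X₁ 𝒳) :
    IsClosed (C.addKer : Set (WithLp 1 (X₀ × X₁))) :=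
  C.addMap.isClosed_ker

/-- The space `X₀ + X₁` with `‖f‖ = inf {‖x₀‖ + ‖x₁‖ : f = x₀ + x₁}`. The subspace
`X₀ + X₁` of `𝒳` is realised as the quotient of `X₀ × X₁` by the kernel of addition. -/
abbrev Sum (C : CompatibleCouple X₀ X₁ 𝒳) : Type _ := WithLp 1 (X₀ × X₁) ⧸ C.addKer

/-- The canonical injection of `X₀ + X₁` into `𝒳`. -/
noncomputable def sumIncl (C : CompatibleCouple X₀ X₁ 𝒳) : C.Sum →ₗ[ℝ] 𝒳 :=
  C.addKer.liftQ C.addMap.toLinearMap le_rfl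

theorem sumIncl_injective (C : CompatibleCouple X₀ X₁ 𝒳) : Function.Injective C.sumIncl :=
  LinearMap.ker_eq_bot.mp (Submodule.ker_liftQ_eq_bot' _ _ rfl)

/-- `X₀` inside `X₀ + X₁`. -/
noncomputable def inl (C : CompatibleCouple X₀ X₁ 𝒳) (x : X₀) : C.Sum :=
  C.addKer.mkQ (WithLp.toLp 1 (x, 0))

/-- `X₁` inside `X₀ + X₁`. -/
noncomputable def inr (C : CompatibleCouple X₀ X₁ 𝒳) (y : X₁) : C.Sum :=
  C.addKer.mkQ (WithLp.toLp 1 (0, y))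

/-- The space `X₀ ∩ X₁` with the norm `max (‖f‖_{X₀}) (‖f‖_{X₁})`: an element is given by its
versions in `X₀` and in `X₁`, which agree in `𝒳`. -/
noncomputable def Inter (C : CompatibleCouple X₀ X₁ 𝒳) : Submodule ℝ (X₀ × X₁) :=
  LinearMap.ker (C.incl₀.toLinearMap.coprod (-C.incl₁.toLinearMap))

theorem mem_Inter (C : CompatibleCouple X₀ X₁ 𝒳) (p : X₀ × X₁) :
    p ∈ C.Inter ↔ C.incl₀ p.1 = C.incl₁ p.2 := by
  simp [Inter, ← sub_eq_add_neg, sub_eq_zero]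

/-- The Peetre `K`-functional `K(f,t;X₀,X₁)`. -/
noncomputable def K (C : CompatibleCouple X₀ X₁ 𝒳) (f : C.Sum) (t : ℝ) : ℝ≥0∞ :=
  ⨅ (x : X₀) (y : X₁) (_ : f = C.inl x + C.inr y), ENNReal.ofReal (‖x‖ + t * ‖y‖)

/-- The Peetre `J`-functional `J(f,t;X₀,X₁)`. -/
noncomputable def J (C : CompatibleCouple X₀ X₁ 𝒳) (f : C.Inter) (t : ℝ) : ℝ≥0∞ :=
  ENNReal.ofReal (max ‖f.1.1‖ (t * ‖f.1.2‖))

/-- `‖t^{-θ-1/q} v(t) g(t)‖_{q,(0,∞)}` for `1 ≤ q < ∞`. -/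
noncomputable def weightedNorm (θ q : ℝ) (v : ℝ → ℝ) (g : ℝ → ℝ≥0∞) : ℝ≥0∞ :=
  (∫⁻ t in Ioi (0 : ℝ), (ENNReal.ofReal (t ^ (-θ - 1 / q) * v t) * g t) ^ q) ^ (1 / q)

/-! A normed subspace of `X₀ + X₁` is given by its norm, extended by `∞` to all of
`X₀ + X₁`; the space is the set of all `f` at which the extended norm is finite. -/

/-- The norm of `X₀`, as a subspace of `X₀ + X₁`. -/
noncomputable def norm₀ (C : CompatibleCouple X₀ X₁ 𝒳) (f : C.Sum) : ℝ≥0∞ :=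
  ⨅ (x : X₀) (_ : f = C.inl x), ENNReal.ofReal ‖x‖

/-- The norm of `(X₀, X₁)_{θ,q,v;K}`. -/
noncomputable def normK (C : CompatibleCouple X₀ X₁ 𝒳) (θ q : ℝ) (v : ℝ → ℝ) (f : C.Sum) :
    ℝ≥0∞ :=
  weightedNorm θ q v (C.K f)

/-- `u : (0,∞) → X₀ ∩ X₁` is strongly measurable and `f = ∫₀^∞ u(s) ds/s` as a (convergent)
Bochner integral in `X₀ + X₁`. -/
structure Represents (C : CompatibleCouple X₀ X₁ 𝒳) (u : ℝ → C.Inter) (f : C.Sum) : Prop where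
  stronglyMeasurable : AEStronglyMeasurable u (volume.restrict (Ioi 0))
  integrable : IntegrableOn (fun s : ℝ => s⁻¹ • C.inl (u s).1.1) (Ioi 0)
  integral_eq : ∫ s in Ioi (0 : ℝ), s⁻¹ • C.inl (u s).1.1 = f

/-- The norm of `(X₀, X₁)_{θ,q,v;J}`; it is `∞` if `f` has no representation. -/
noncomputable def normJ (C : CompatibleCouple X₀ X₁ 𝒳) (θ q : ℝ) (v : ℝ → ℝ) (f : C.Sum) :
    ℝ≥0∞ :=
  ⨅ (u : ℝ → C.Inter) (_ : C.Represents u f), weightedNorm θ q v (fun t => C.J (u t) t)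

end CompatibleCouple

/-- The norm of the sum `Y + Z` of two subspaces with norms `N` and `M`:
`inf {‖g‖_Y + ‖h‖_Z : f = g + h}`. -/
noncomputable def sumNorm {E : Type*} [AddCommGroup E] (N M : E → ℝ≥0∞) (f : E) : ℝ≥0∞ :=
  ⨅ (g : E) (h : E) (_ : f = g + h), N g + M h

/-- The spaces `{N < ∞}` and `{M < ∞}` coincide, with equivalent norms. -/
def SpacesCoincide {E : Type*} (N M : E → ℝ≥0∞) : Prop :=
  {f | N f < ∞} = {f | M f < ∞} ∧
    ∃ c C : ℝ≥0, 0 < c ∧ 0 < C ∧ ∀ f, N f < ∞ → c * N f ≤ M f ∧ M f ≤ C * N f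

/-!
Put `V(t) = ∫_t^∞ s⁻¹ B(s)^q ds`, so that `A = B^{1-q} V`. Slow variation of `B` enters through
`B^q ≲ V`, and through the bounds `B(t) ≳ t^{-ε}` for `t ≥ 1` and `B(t) ≲ t^{-ε}` for `t ≤ 1`.

**First identity.** The weights `b` and `B` agree on `[1,∞)`, and on `(0,1)` only `K(f,1)` matters.
For `f ∈ (X₀,X₁)_{0,q,B;K}`, `K(f,t) ≤ K(f,1)` for `t < 1`, where `t⁻¹ b^q` is integrable.
Conversely, if `f = x + y` is nearly optimal for `K(f,1)`, then `K(y,t) ≤ t ‖y‖` for `t < 1`, and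
`t^{q-1} B^q` is integrable on `(0,1)`. See `exists_normK_le_mul_sumNorm` and `exists_sumNorm_le_mul_normK`.

**From `J` to `K`.** If `f = ∫ u ds/s`, then
`K(f,t) ≤ ∫_0^t J(u(s),s) ds/s + t ∫_t^∞ s⁻² J(u(s),s) ds`. The two terms are bounded by Hardy
inequalities: `IsTail.exists_hardy`, relative to the measure `t⁻¹ B^q dt` and its tail function `V`,
and `IsSlowlyVarying.exists_hardy_tail`, for the weight `B ≲ A`. See `exists_normK_le_mul_normJ`.

**From `K` to `J`.** Choose points `1 ≤ T₀ < T₁ < …` between which `V` halves, and decompositions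
`f = x_k + y_k` that are nearly optimal for `K(f,T_k)`. Then `y_k → 0`, so
`f - x₁ = ∑_{k ≥ 0} (x_{k+2} - x_{k+1})`; the summand `X₀` absorbs `x₁`, which makes the interval
`(0,1)` irrelevant. As `A` may be much larger than `B`, the term `d_k = x_{k+2} - x_{k+1}` must be
spread over a long interval. It is spread over `(T_k, T_{k+1}]` with density proportional to `B^q`;
to the left of `T_{k+1}` one has `J(d_k,s) ≲ K(f,T_{k+2})`, and `A · 2^k B^q ≲ B` there. So the
contribution of `d_k` to the norm is bounded by `K(f,T_{k+2})^q` times the measure of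
`(T_{k+2}, T_{k+3}]`, hence by the integral of `t⁻¹ B^q K(f,t)^q` over that interval.
See `exists_represents`.
-/

/-! ### The embeddings and the `K`-functional -/

namespace CompatibleCouple

variable {X₀ X₁ 𝒳 : Type*}
  [NormedAddCommGroup X₀] [NormedSpace ℝ X₀] [NormedAddCommGroup X₁] [NormedSpace ℝ X₁]
  [AddCommGroup 𝒳] [Module ℝ 𝒳] [TopologicalSpace 𝒳] [IsTopologicalAddGroup 𝒳]
  [ContinuousSMul ℝ 𝒳] [T2Space 𝒳]

/-- The embedding `X₀ → X₀ + X₁` as a continuous linear map. -/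
noncomputable def inlL (C : CompatibleCouple X₀ X₁ 𝒳) : X₀ →L[ℝ] C.Sum :=
  C.addKer.mkQL.comp (((WithLp.prodContinuousLinearEquiv 1 ℝ X₀ X₁).symm.toContinuousLinearMap).comp
    (ContinuousLinearMap.inl ℝ X₀ X₁))

/-- The embedding `X₁ → X₀ + X₁` as a continuous linear map. -/
noncomputable def inrL (C : CompatibleCouple X₀ X₁ 𝒳) : X₁ →L[ℝ] C.Sum :=
  C.addKer.mkQL.comp (((WithLp.prodContinuousLinearEquiv 1 ℝ X₀ X₁).symm.toContinuousLinearMap).comp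
    (ContinuousLinearMap.inr ℝ X₀ X₁))

theorem inlL_apply (C : CompatibleCouple X₀ X₁ 𝒳) (x : X₀) : C.inlL x = C.inl x := rfl

theorem inrL_apply (C : CompatibleCouple X₀ X₁ 𝒳) (y : X₁) : C.inrL y = C.inr y := rfl

theorem inl_zero (C : CompatibleCouple X₀ X₁ 𝒳) : C.inl 0 = 0 := C.inlL.map_zero

theorem inr_zero (C : CompatibleCouple X₀ X₁ 𝒳) : C.inr 0 = 0 := C.inrL.map_zero

theorem inl_add (C : CompatibleCouple X₀ X₁ 𝒳) (x x' : X₀) :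
    C.inl (x + x') = C.inl x + C.inl x' := C.inlL.map_add x x'

theorem inr_add (C : CompatibleCouple X₀ X₁ 𝒳) (y y' : X₁) :
    C.inr (y + y') = C.inr y + C.inr y' := C.inrL.map_add y y'

theorem inl_sub (C : CompatibleCouple X₀ X₁ 𝒳) (x x' : X₀) :
    C.inl (x - x') = C.inl x - C.inl x' := C.inlL.map_sub x x'

theorem inr_sub (C : CompatibleCouple X₀ X₁ 𝒳) (y y' : X₁) :
    C.inr (y - y') = C.inr y - C.inr y' := C.inrL.map_sub y y'

theorem inl_neg (C : CompatibleCouple X₀ X₁ 𝒳) (x : X₀) : C.inl (-x) = -C.inl x :=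
  C.inlL.map_neg x

theorem norm_inl_add_inr_le (C : CompatibleCouple X₀ X₁ 𝒳) (x : X₀) (y : X₁) :
    ‖C.inl x + C.inr y‖ ≤ ‖x‖ + ‖y‖ := by
  have h : C.inl x + C.inr y = C.addKer.mkQ (WithLp.toLp 1 (x, y)) := by
    simp only [inl, inr, ← map_add, ← WithLp.toLp_add, Prod.mk_add_mk, add_zero, zero_add]
  rw [h]
  refine (Submodule.Quotient.norm_mk_le C.addKer (WithLp.toLp 1 (x, y))).trans ?_
  exact (WithLp.prod_norm_eq_of_L1 _).le

theorem norm_inr_le (C : CompatibleCouple X₀ X₁ 𝒳) (y : X₁) : ‖C.inr y‖ ≤ ‖y‖ := by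
  simpa [inl_zero] using C.norm_inl_add_inr_le 0 y

theorem exists_eq_inl_add_inr (C : CompatibleCouple X₀ X₁ 𝒳) (f : C.Sum) :
    ∃ x y, f = C.inl x + C.inr y := by
  obtain ⟨p, rfl⟩ := C.addKer.mkQ_surjective f
  refine ⟨p.fst, p.snd, ?_⟩
  simp only [inl, inr, ← map_add, ← WithLp.toLp_add, Prod.mk_add_mk, add_zero, zero_add]
  rfl

/-- The two versions of an element of `X₀ ∩ X₁` coincide in `X₀ + X₁`. -/
theorem inl_fst_eq_inr_snd (C : CompatibleCouple X₀ X₁ 𝒳) (p : C.Inter) :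
    C.inl p.1.1 = C.inr p.1.2 := by
  have h := (C.mem_Inter p.1).1 p.2
  apply C.sumIncl_injective
  simpa [inl, inr, sumIncl, addMap] using h

/-- Elements of `X₀` and `X₁` with the same image in `X₀ + X₁` form an element of `X₀ ∩ X₁`. -/
theorem mem_Inter_of_inl_eq_inr (C : CompatibleCouple X₀ X₁ 𝒳) {x : X₀} {y : X₁}
    (h : C.inl x = C.inr y) : (x, y) ∈ C.Inter := by
  rw [C.mem_Inter]
  have := congrArg C.sumIncl h
  simpa [inl, inr, sumIncl, addMap] using this

theorem K_le (C : CompatibleCouple X₀ X₁ 𝒳) {f : C.Sum} {x : X₀} {y : X₁}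
    (h : f = C.inl x + C.inr y) (t : ℝ) : C.K f t ≤ ENNReal.ofReal (‖x‖ + t * ‖y‖) :=
  iInf_le_of_le x (iInf_le_of_le y (iInf_le _ h))

theorem le_K (C : CompatibleCouple X₀ X₁ 𝒳) {f : C.Sum} {t : ℝ} {a : ℝ≥0∞}
    (h : ∀ x y, f = C.inl x + C.inr y → a ≤ ENNReal.ofReal (‖x‖ + t * ‖y‖)) : a ≤ C.K f t :=
  le_iInf fun x => le_iInf fun y => le_iInf fun e => h x y e

theorem K_lt_top (C : CompatibleCouple X₀ X₁ 𝒳) (f : C.Sum) (t : ℝ) : C.K f t < ∞ := by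
  obtain ⟨x, y, h⟩ := C.exists_eq_inl_add_inr f
  exact (C.K_le h t).trans_lt ENNReal.ofReal_lt_top

theorem monotone_K (C : CompatibleCouple X₀ X₁ 𝒳) (f : C.Sum) : Monotone (C.K f) := by
  intro s t hst
  refine C.le_K fun x y h => (C.K_le h s).trans (ENNReal.ofReal_le_ofReal ?_)
  gcongr

theorem measurable_K (C : CompatibleCouple X₀ X₁ 𝒳) (f : C.Sum) : Measurable (C.K f) :=
  (C.monotone_K f).measurable

theorem K_inl_le (C : CompatibleCouple X₀ X₁ 𝒳) (x : X₀) (t : ℝ) :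
    C.K (C.inl x) t ≤ ENNReal.ofReal ‖x‖ := by
  simpa using C.K_le (f := C.inl x) (x := x) (y := 0) (by simp [inr_zero]) t

theorem K_inr_le (C : CompatibleCouple X₀ X₁ 𝒳) (y : X₁) (t : ℝ) :
    C.K (C.inr y) t ≤ ENNReal.ofReal (t * ‖y‖) := by
  simpa using C.K_le (f := C.inr y) (x := 0) (y := y) (by simp [inl_zero]) t

theorem K_add_le (C : CompatibleCouple X₀ X₁ 𝒳) (f g : C.Sum) {t : ℝ} (ht : 0 ≤ t) :
    C.K (f + g) t ≤ C.K f t + C.K g t := by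
  simp only [K, ENNReal.iInf_add, ENNReal.add_iInf]
  refine le_iInf fun x => le_iInf fun y => le_iInf fun h => le_iInf fun x' => le_iInf fun y' =>
    le_iInf fun h' => ?_
  refine (C.K_le (x := x' + x) (y := y' + y) ?_ t).trans ?_
  · rw [h, h', inl_add, inr_add]; abel
  · rw [← ENNReal.ofReal_add (by positivity) (by positivity)]
    apply ENNReal.ofReal_le_ofReal
    nlinarith [norm_add_le x' x, mul_le_mul_of_nonneg_left (norm_add_le y' y) ht]

theorem ofReal_norm_le_K_one (C : CompatibleCouple X₀ X₁ 𝒳) (f : C.Sum) :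
    ENNReal.ofReal ‖f‖ ≤ C.K f 1 := by
  refine C.le_K fun x y h => ENNReal.ofReal_le_ofReal ?_
  rw [h, one_mul]
  exact C.norm_inl_add_inr_le x y

/-- A decomposition that is optimal for `K(f,t)` up to a factor `2`, in real numbers. For `f ≠ 0`
it exists since `K(f,t) > 0`. -/
theorem exists_decomposition_le_two_mul_K (C : CompatibleCouple X₀ X₁ 𝒳) {f : C.Sum} (hf : f ≠ 0)
    {t : ℝ} (ht : 1 ≤ t) :
    ∃ x y, f = C.inl x + C.inr y ∧ ‖x‖ + t * ‖y‖ ≤ 2 * (C.K f t).toReal := by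
  have h0 : 0 < C.K f t := by
    refine lt_of_lt_of_le ?_ ((C.ofReal_norm_le_K_one f).trans (C.monotone_K f ht))
    exact ENNReal.ofReal_pos.2 (norm_pos_iff.2 hf)
  by_contra! H
  have : ENNReal.ofReal (2 * (C.K f t).toReal) ≤ C.K f t :=
    C.le_K fun x y h => ENNReal.ofReal_le_ofReal (H x y h).le
  rw [ENNReal.ofReal_le_iff_le_toReal (C.K_lt_top f t).ne] at this
  have h1 := ENNReal.toReal_pos h0.ne' (C.K_lt_top f t).ne
  linarith

theorem norm₀_inl_le (C : CompatibleCouple X₀ X₁ 𝒳) (x : X₀) :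
    C.norm₀ (C.inl x) ≤ ENNReal.ofReal ‖x‖ :=
  iInf_le_of_le x (iInf_le _ rfl)

theorem norm₀_add_le (C : CompatibleCouple X₀ X₁ 𝒳) (f g : C.Sum) :
    C.norm₀ (f + g) ≤ C.norm₀ f + C.norm₀ g := by
  simp only [norm₀, ENNReal.iInf_add, ENNReal.add_iInf]
  refine le_iInf fun x => le_iInf fun h => le_iInf fun x' => le_iInf fun h' => ?_
  refine iInf_le_of_le (x' + x) (iInf_le_of_le (by rw [h, h', inl_add, add_comm]) ?_)
  rw [← ENNReal.ofReal_add (by positivity) (by positivity)]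
  exact ENNReal.ofReal_le_ofReal (norm_add_le _ _)

/-! ### Weighted norms -/

theorem weightedNorm_eq {q : ℝ} (hq : 1 ≤ q) {v : ℝ → ℝ} (hv : ∀ t, 0 < t → 0 < v t)
    (g : ℝ → ℝ≥0∞) :
    weightedNorm 0 q v g =
      (∫⁻ t in Ioi (0 : ℝ), ENNReal.ofReal (t⁻¹ * v t ^ q) * g t ^ q) ^ (1 / q) := by
  have hq0 : 0 < q := by linarith
  unfold weightedNorm
  congr 1
  refine setLIntegral_congr_fun measurableSet_Ioi fun t ht => ?_
  have ht : 0 < t := ht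
  have hv := hv t ht
  rw [ENNReal.mul_rpow_of_nonneg _ _ hq0.le, ENNReal.ofReal_rpow_of_nonneg (by positivity) hq0.le,
    Real.mul_rpow (by positivity) hv.le, ← Real.rpow_mul ht.le]
  congr 4
  rw [← Real.rpow_neg_one]
  congr 1
  field_simp
  ring

theorem weightedNorm_rpow {q : ℝ} (hq : 1 ≤ q) {v : ℝ → ℝ} (hv : ∀ t, 0 < t → 0 < v t)
    (g : ℝ → ℝ≥0∞) :
    weightedNorm 0 q v g ^ q =
      ∫⁻ t in Ioi (0 : ℝ), ENNReal.ofReal (t⁻¹ * v t ^ q) * g t ^ q := by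
  rw [weightedNorm_eq hq hv, ← ENNReal.rpow_mul, one_div_mul_cancel (by linarith),
    ENNReal.rpow_one]

theorem weightedNorm_add_le {q : ℝ} (hq : 1 ≤ q) {v : ℝ → ℝ}
    (hvm : AEMeasurable v (volume.restrict (Ioi 0))) {g h : ℝ → ℝ≥0∞} (hg : Measurable g)
    (hh : Measurable h) :
    weightedNorm 0 q v (g + h) ≤ weightedNorm 0 q v g + weightedNorm 0 q v h := by
  have hw : AEMeasurable (fun t : ℝ => ENNReal.ofReal (t ^ (-0 - 1 / q) * v t))
      (volume.restrict (Ioi 0)) :=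
    ((Measurable.aemeasurable (by fun_prop)).mul hvm).ennreal_ofReal
  have := ENNReal.lintegral_Lp_add_le (hw.mul hg.aemeasurable) (hw.mul hh.aemeasurable) hq
  simpa [weightedNorm, mul_add] using this

theorem weightedNorm_mono {q : ℝ} (hq : 1 ≤ q) {v : ℝ → ℝ} {g h : ℝ → ℝ≥0∞}
    (H : ∀ t, 0 < t → g t ≤ h t) : weightedNorm 0 q v g ≤ weightedNorm 0 q v h := by
  have hq0 : 0 < q := by linarith
  unfold weightedNorm
  gcongr ?_ ^ _
  refine setLIntegral_mono' measurableSet_Ioi fun t ht => ?_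
  gcongr
  exact H t ht

theorem normK_add_le (C : CompatibleCouple X₀ X₁ 𝒳) {q : ℝ} (hq : 1 ≤ q) {v : ℝ → ℝ}
    (hvm : AEMeasurable v (volume.restrict (Ioi 0))) (f g : C.Sum) :
    C.normK 0 q v (f + g) ≤ C.normK 0 q v f + C.normK 0 q v g :=
  (weightedNorm_mono hq fun _ ht => C.K_add_le f g (le_of_lt ht)).trans
    (weightedNorm_add_le hq hvm (C.measurable_K f) (C.measurable_K g))

/-- `K(f,t) (∫_t^∞ s⁻¹ v(s)^q ds)^{1/q} ≤ ‖f‖_{0,q,v;K}`, since `K(f,·)` increases. -/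
theorem setLIntegral_mul_K_rpow_le (C : CompatibleCouple X₀ X₁ 𝒳) {q : ℝ} (hq : 1 ≤ q)
    {v : ℝ → ℝ} (hv : ∀ t, 0 < t → 0 < v t) (f : C.Sum) {t : ℝ} (ht : 0 < t) :
    (∫⁻ s in Ioi t, ENNReal.ofReal (s⁻¹ * v s ^ q)) * C.K f t ^ q ≤ C.normK 0 q v f ^ q := by
  have hq0 : 0 < q := by linarith
  rw [normK, weightedNorm_rpow hq hv,
    ← lintegral_mul_const' _ _ (ENNReal.rpow_ne_top_of_nonneg hq0.le (C.K_lt_top f t).ne)]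
  refine (setLIntegral_mono' measurableSet_Ioi fun s hs => ?_).trans
    (lintegral_mono_set (Ioi_subset_Ioi ht.le))
  gcongr
  exact C.monotone_K f (le_of_lt hs)

end CompatibleCouple

/-! ### Comparing extended norms -/

theorem spacesCoincide_of_le {E : Type*} {N M : E → ℝ≥0∞} {C C' : ℝ≥0}
    (h : ∀ f, N f ≤ C * M f) (h' : ∀ f, M f ≤ C' * N f) : SpacesCoincide N M := by
  refine ⟨?_, (C + 1)⁻¹, C' + 1, by positivity, by positivity, fun f _ => ⟨?_, ?_⟩⟩
  · ext f
    exact ⟨fun hf => (h' f).trans_lt (ENNReal.mul_lt_top ENNReal.coe_lt_top hf),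
      fun hf => (h f).trans_lt (ENNReal.mul_lt_top ENNReal.coe_lt_top hf)⟩
  · rw [ENNReal.coe_inv (by positivity), ENNReal.inv_mul_le_iff (by simp) (by simp)]
    exact (h f).trans (by gcongr; simp)
  · exact (h' f).trans (by gcongr; simp)

theorem sumNorm_le {E : Type*} [AddCommGroup E] (N M : E → ℝ≥0∞) {f g h : E} (e : f = g + h) :
    sumNorm N M f ≤ N g + M h :=
  iInf_le_of_le g (iInf_le_of_le h (iInf_le _ e))

theorem le_sumNorm {E : Type*} [AddCommGroup E] {N M : E → ℝ≥0∞} {f : E} {a : ℝ≥0∞}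
    (H : ∀ g h, f = g + h → a ≤ N g + M h) : a ≤ sumNorm N M f :=
  le_iInf fun g => le_iInf fun h => le_iInf fun e => H g h e

/-! ### Slowly varying functions -/

namespace IsSlowlyVarying

theorem rpow_mul_le {b : ℝ → ℝ} (hb : IsSlowlyVarying b) {ε : ℝ} (hε : 0 < ε) :
    ∃ C : ℝ, 0 < C ∧ ∀ s t, 0 < s → s ≤ t → s ^ ε * b s ≤ C * (t ^ ε * b t) := by
  obtain ⟨g, hg, c, C, hc, hC, h⟩ := hb.incr ε hε
  refine ⟨C / c, by positivity, fun s t hs hst => ?_⟩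
  have ht : 0 < t := hs.trans_le hst
  have h1 := (h s hs).2
  have h2 := (h t ht).1
  have h3 := hg hs ht hst
  calc s ^ ε * b s ≤ C * g s := h1
    _ ≤ C * g t := by gcongr
    _ = C / c * (c * g t) := by field_simp
    _ ≤ C / c * (t ^ ε * b t) := by gcongr

theorem aemeasurable_inv_mul_rpow {b : ℝ → ℝ} (hb : IsSlowlyVarying b) (q : ℝ) :
    AEMeasurable (fun t => t⁻¹ * b t ^ q) (volume.restrict (Ioi 0)) :=
  (Measurable.aemeasurable (by fun_prop)).mul (hb.measurable.pow_const q)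

/-- A slowly varying `b` satisfies `b(t)^q ≲ ∫_t^∞ s⁻¹ b(s)^q ds`; already the integral over
`(t, 2t)` is large enough. -/
theorem exists_mul_rpow_le_setLIntegral {b : ℝ → ℝ} (hb : IsSlowlyVarying b) {q : ℝ}
    (hq : 1 ≤ q) :
    ∃ c : ℝ, 0 < c ∧ ∀ t, 0 < t →
      ENNReal.ofReal (c * b t ^ q) ≤ ∫⁻ s in Ioi t, ENNReal.ofReal (s⁻¹ * b s ^ q) := by
  obtain ⟨C, hC, h⟩ := hb.rpow_mul_le one_pos
  refine ⟨2⁻¹ * (2 * C)⁻¹ ^ q, by positivity, fun t ht => ?_⟩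
  have hbt := hb.pos t ht
  have key : ∀ s ∈ Ioc t (2 * t), ENNReal.ofReal ((2 * t)⁻¹ * ((2 * C)⁻¹ * b t) ^ q) ≤
      ENNReal.ofReal (s⁻¹ * b s ^ q) := by
    intro s hs
    have hs0 : 0 < s := ht.trans hs.1
    have hbs := hb.pos s hs0
    have h1 := h t s ht hs.1.le
    simp only [Real.rpow_one] at h1
    apply ENNReal.ofReal_le_ofReal
    gcongr
    · exact hs.2
    · rw [inv_mul_le_iff₀ (by positivity)]
      refine le_of_mul_le_mul_left (h1.trans ?_) ht
      nlinarith [mul_le_mul_of_nonneg_right hs.2 (mul_pos hC hbs).le]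
  calc ENNReal.ofReal (2⁻¹ * (2 * C)⁻¹ ^ q * b t ^ q)
      = ∫⁻ s in Ioc t (2 * t), ENNReal.ofReal ((2 * t)⁻¹ * ((2 * C)⁻¹ * b t) ^ q) := by
        rw [setLIntegral_const, Real.volume_Ioc, ← ENNReal.ofReal_mul (by positivity),
          Real.mul_rpow (by positivity) hbt.le]
        congr 1
        field_simp
        ring
    _ ≤ ∫⁻ s in Ioc t (2 * t), ENNReal.ofReal (s⁻¹ * b s ^ q) :=
        setLIntegral_mono' measurableSet_Ioc key
    _ ≤ _ := lintegral_mono_set Ioc_subset_Ioi_self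

theorem setLIntegral_Ioi_pos {b : ℝ → ℝ} (hb : IsSlowlyVarying b) {q : ℝ} (hq : 1 ≤ q) {t : ℝ}
    (ht : 0 < t) : 0 < ∫⁻ s in Ioi t, ENNReal.ofReal (s⁻¹ * b s ^ q) := by
  obtain ⟨c, hc, h⟩ := hb.exists_mul_rpow_le_setLIntegral hq
  have := hb.pos t ht
  exact lt_of_lt_of_le (ENNReal.ofReal_pos.2 (by positivity)) (h t ht)

/-- Finiteness at `1` suffices, as slowly varying functions are bounded on `(t, 1]`. -/
theorem setLIntegral_Ioi_lt_top {b : ℝ → ℝ} (hb : IsSlowlyVarying b) {q : ℝ} (hq : 1 ≤ q)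
    (h1 : ∫⁻ s in Ioi (1 : ℝ), ENNReal.ofReal (s⁻¹ * b s ^ q) < ∞) {t : ℝ} (ht : 0 < t) :
    ∫⁻ s in Ioi t, ENNReal.ofReal (s⁻¹ * b s ^ q) < ∞ := by
  obtain ⟨C, hC, h⟩ := hb.rpow_mul_le one_pos
  have hb1 := hb.pos 1 one_pos
  have key : ∀ s ∈ Ioc t 1, ENNReal.ofReal (s⁻¹ * b s ^ q) ≤
      ENNReal.ofReal (t⁻¹ * (C * b 1 / t) ^ q) := by
    intro s hs
    have hs0 : 0 < s := ht.trans hs.1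
    have hbs := hb.pos s hs0
    have h1 := h s 1 hs0 hs.2
    simp only [Real.rpow_one, one_mul] at h1
    apply ENNReal.ofReal_le_ofReal
    gcongr
    · exact hs.1.le
    · rw [le_div_iff₀ ht]
      nlinarith [mul_le_mul_of_nonneg_right hs.1.le hbs.le]
  have hsub : Ioi t ⊆ Ioc t 1 ∪ Ioi 1 := fun s hs => by
    rcases le_or_gt s 1 with h | h
    · exact Or.inl ⟨hs, h⟩
    · exact Or.inr h
  refine (lintegral_mono_set hsub).trans_lt ((lintegral_union_le _ _ _).trans_lt
    (ENNReal.add_lt_top.2 ⟨?_, h1⟩))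
  refine (setLIntegral_mono' measurableSet_Ioc key).trans_lt ?_
  rw [setLIntegral_const]
  exact ENNReal.mul_lt_top ENNReal.ofReal_lt_top (by simp)

/-- The weighted norm over `(0,1]` of `t ↦ t`, which dominates `K(y,t)` for `y ∈ X₁`, is finite. -/
theorem setLIntegral_Ioc_mul_rpow_lt_top {b : ℝ → ℝ} (hb : IsSlowlyVarying b) {q : ℝ}
    (hq : 1 ≤ q) :
    ∫⁻ t in Ioc (0 : ℝ) 1, ENNReal.ofReal (t⁻¹ * b t ^ q) * ENNReal.ofReal t ^ q < ∞ := by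
  obtain ⟨C, hC, h⟩ := hb.rpow_mul_le (half_pos one_pos)
  have hb1 := hb.pos 1 one_pos
  have hi : IntegrableOn (fun t : ℝ => (C * b 1) ^ q * t ^ (q / 2 - 1)) (Ioc 0 1) :=
    (((intervalIntegrable_iff_integrableOn_Ioc_of_le zero_le_one).1
      (intervalIntegral.intervalIntegrable_rpow' (by linarith))).const_mul _)
  refine lt_of_le_of_lt (setLIntegral_mono' measurableSet_Ioc fun t ht => ?_)
    hi.lintegral_lt_top
  have ht0 : 0 < t := ht.1
  have hbt := hb.pos t ht0
  have h1 := h t 1 ht0 ht.2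
  simp only [Real.one_rpow, one_mul] at h1
  rw [ENNReal.ofReal_rpow_of_nonneg ht0.le (by linarith), ← ENNReal.ofReal_mul (by positivity)]
  apply ENNReal.ofReal_le_ofReal
  calc t⁻¹ * b t ^ q * t ^ q = (t ^ (1 / 2 : ℝ) * b t) ^ q * t ^ (q / 2 - 1) := by
        rw [Real.mul_rpow (by positivity) hbt.le, ← Real.rpow_mul ht0.le, Real.rpow_sub_one ht0.ne']
        have : t ^ q = t ^ (1 / 2 * q) * t ^ (q / 2) := by
          rw [← Real.rpow_add ht0]; ring_nf
        rw [this]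
        field_simp
    _ ≤ _ := by gcongr

/-- A slowly varying function decays more slowly than any negative power. -/
theorem exists_mul_rpow_neg_le {b : ℝ → ℝ} (hb : IsSlowlyVarying b) {ε : ℝ} (hε : 0 < ε) :
    ∃ c : ℝ, 0 < c ∧ ∀ t, 1 ≤ t → c * t ^ (-ε) ≤ b t := by
  obtain ⟨C, hC, h⟩ := hb.rpow_mul_le hε
  have hb1 := hb.pos 1 one_pos
  refine ⟨b 1 / C, by positivity, fun t ht => ?_⟩
  have h1 := h 1 t one_pos ht
  simp only [Real.one_rpow, one_mul] at h1
  have ht0 : 0 < t := by linarith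
  rw [Real.rpow_neg ht0.le]
  field_simp
  linarith

end IsSlowlyVarying

/-! ### The first identity -/

namespace CompatibleCouple

variable {X₀ X₁ 𝒳 : Type*}
  [NormedAddCommGroup X₀] [NormedSpace ℝ X₀] [NormedAddCommGroup X₁] [NormedSpace ℝ X₁]
  [AddCommGroup 𝒳] [Module ℝ 𝒳] [TopologicalSpace 𝒳] [IsTopologicalAddGroup 𝒳]
  [ContinuousSMul ℝ 𝒳] [T2Space 𝒳]

theorem K_le_mul_normK (C : CompatibleCouple X₀ X₁ 𝒳) {q : ℝ} (hq : 1 ≤ q)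
    {v : ℝ → ℝ} (hv : ∀ t, 0 < t → 0 < v t) (f : C.Sum) {t : ℝ} (ht : 0 < t)
    (h0 : ∫⁻ s in Ioi t, ENNReal.ofReal (s⁻¹ * v s ^ q) ≠ 0)
    (h1 : ∫⁻ s in Ioi t, ENNReal.ofReal (s⁻¹ * v s ^ q) ≠ ∞) :
    C.K f t ≤ ((∫⁻ s in Ioi t, ENNReal.ofReal (s⁻¹ * v s ^ q))⁻¹) ^ (1 / q) *
      C.normK 0 q v f := by
  have hq0 : 0 < q := by linarith
  rw [← ENNReal.rpow_le_rpow_iff hq0, ENNReal.mul_rpow_of_nonneg _ _ hq0.le, ← ENNReal.rpow_mul,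
    one_div_mul_cancel hq0.ne', ENNReal.rpow_one,
    ← ENNReal.inv_mul_le_iff (ENNReal.inv_ne_zero.2 h1) (ENNReal.inv_ne_top.2 h0), inv_inv]
  exact C.setLIntegral_mul_K_rpow_le hq hv f ht

theorem weightedNorm_le_add_of_eq_on_Ici {q : ℝ} (hq : 1 ≤ q) {v w : ℝ → ℝ}
    (hv : ∀ t, 0 < t → 0 < v t) (hw : ∀ t, 0 < t → 0 < w t) (hvw : ∀ t, 1 ≤ t → v t = w t)
    (g : ℝ → ℝ≥0∞) :
    weightedNorm 0 q v g ≤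
      (∫⁻ t in Ioc (0 : ℝ) 1, ENNReal.ofReal (t⁻¹ * v t ^ q) * g t ^ q) ^ (1 / q) +
        weightedNorm 0 q w g := by
  have hq0 : 0 < q := by linarith
  rw [weightedNorm_eq hq hv, weightedNorm_eq hq hw, ← Ioc_union_Ioi_eq_Ioi (zero_le_one' ℝ)]
  refine (ENNReal.rpow_le_rpow (lintegral_union_le _ _ _) (by positivity)).trans
    ((ENNReal.rpow_add_le_add_rpow _ _ (by positivity) ?_).trans ?_)
  · rw [div_le_one hq0]; exact hq
  refine add_le_add le_rfl (ENNReal.rpow_le_rpow ?_ (by positivity))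
  rw [setLIntegral_congr_fun (g := fun t => ENNReal.ofReal (t⁻¹ * w t ^ q) * g t ^ q)
    measurableSet_Ioi fun t ht => by rw [hvw t (le_of_lt ht)]]
  exact lintegral_mono_set subset_union_right

theorem setLIntegral_mul_const_rpow {q : ℝ} (hq : 1 ≤ q) (s : Set ℝ) (v : ℝ → ℝ≥0∞)
    {a : ℝ≥0∞} (ha : a ≠ ∞) :
    (∫⁻ t in s, v t * a ^ q) ^ (1 / q) = (∫⁻ t in s, v t) ^ (1 / q) * a := by
  have hq0 : 0 < q := by linarith
  rw [lintegral_mul_const' _ _ (ENNReal.rpow_ne_top_of_nonneg hq0.le ha),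
    ENNReal.mul_rpow_of_nonneg _ _ (by positivity), ← ENNReal.rpow_mul,
    mul_one_div_cancel hq0.ne', ENNReal.rpow_one]

theorem normK_inl_le (C : CompatibleCouple X₀ X₁ 𝒳) {q : ℝ} (hq : 1 ≤ q)
    {v : ℝ → ℝ} (hv : ∀ t, 0 < t → 0 < v t) (x : X₀) :
    C.normK 0 q v (C.inl x) ≤
      (∫⁻ t in Ioi (0 : ℝ), ENNReal.ofReal (t⁻¹ * v t ^ q)) ^ (1 / q) * ENNReal.ofReal ‖x‖ := by
  refine (weightedNorm_mono hq (h := fun _ => ENNReal.ofReal ‖x‖)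
    fun t _ => C.K_inl_le x t).trans ?_
  rw [weightedNorm_eq hq hv, setLIntegral_mul_const_rpow hq _ _ ENNReal.ofReal_ne_top]

theorem normK_le_mul_norm₀ (C : CompatibleCouple X₀ X₁ 𝒳) {q : ℝ} (hq : 1 ≤ q)
    {v : ℝ → ℝ} (hv : ∀ t, 0 < t → 0 < v t)
    (hfin : ∫⁻ t in Ioi (0 : ℝ), ENNReal.ofReal (t⁻¹ * v t ^ q) < ∞)
    (hpos : 0 < ∫⁻ t in Ioi (0 : ℝ), ENNReal.ofReal (t⁻¹ * v t ^ q)) (f : C.Sum) :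
    C.normK 0 q v f ≤
      (∫⁻ t in Ioi (0 : ℝ), ENNReal.ofReal (t⁻¹ * v t ^ q)) ^ (1 / q) * C.norm₀ f := by
  have hq0 : 0 < q := by linarith
  have h0 := (ENNReal.rpow_pos hpos hfin.ne (p := 1 / q)).ne'
  have h1 := ENNReal.rpow_ne_top_of_nonneg (y := 1 / q) (by positivity) hfin.ne
  rw [← ENNReal.inv_mul_le_iff h0 h1]
  refine le_iInf fun x => le_iInf fun h => ?_
  rw [ENNReal.inv_mul_le_iff h0 h1, h]
  exact C.normK_inl_le hq hv x

/-- `X₀ + (X₀,X₁)_{0,q,B;K} ⊆ (X₀,X₁)_{0,q,b;K}`. -/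
theorem exists_normK_le_mul_sumNorm (C : CompatibleCouple X₀ X₁ 𝒳) {q : ℝ} (hq : 1 ≤ q)
    {b B : ℝ → ℝ} (hb : IsSlowlyVarying b) (hB : IsSlowlyVarying B)
    (hb_fin : ∫⁻ t in Ioi (0 : ℝ), ENNReal.ofReal (t⁻¹ * b t ^ q) < ∞)
    (hB_fin : ∫⁻ t in Ioi (1 : ℝ), ENNReal.ofReal (t⁻¹ * B t ^ q) < ∞)
    (hBb : ∀ x : ℝ, 1 ≤ x → B x = b x) :
    ∃ M : ℝ≥0, ∀ f, C.normK 0 q b f ≤ M * sumNorm C.norm₀ (C.normK 0 q B) f := by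
  have hq0 : 0 < q := by linarith
  set I := ∫⁻ t in Ioi (0 : ℝ), ENNReal.ofReal (t⁻¹ * b t ^ q) with hI
  set m := ∫⁻ t in Ioi (1 : ℝ), ENNReal.ofReal (t⁻¹ * B t ^ q) with hm
  have hm0 : 0 < m := hB.setLIntegral_Ioi_pos hq one_pos
  have hI0 : 0 < I := (hb.setLIntegral_Ioi_pos hq one_pos).trans_le
    (lintegral_mono_set (Ioi_subset_Ioi zero_le_one))
  have hIq : I ^ (1 / q) ≠ ∞ := ENNReal.rpow_ne_top_of_nonneg (by positivity) hb_fin.ne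
  have hmq : (m⁻¹) ^ (1 / q) ≠ ∞ :=
    ENNReal.rpow_ne_top_of_nonneg (by positivity) (ENNReal.inv_ne_top.2 hm0.ne')
  have hKB : ∀ h, C.normK 0 q b h ≤ (I ^ (1 / q) * (m⁻¹) ^ (1 / q) + 1) * C.normK 0 q B h := by
    intro h
    refine (weightedNorm_le_add_of_eq_on_Ici hq hb.pos hB.pos (fun t ht => (hBb t ht).symm)
      _).trans ?_
    rw [add_mul, one_mul]
    gcongr ?_ + ?_
    · calc (∫⁻ t in Ioc (0 : ℝ) 1, ENNReal.ofReal (t⁻¹ * b t ^ q) * C.K h t ^ q) ^ (1 / q)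
          ≤ (∫⁻ t in Ioc (0 : ℝ) 1, ENNReal.ofReal (t⁻¹ * b t ^ q) * C.K h 1 ^ q) ^ (1 / q) := by
            gcongr ?_ ^ _
            refine setLIntegral_mono' measurableSet_Ioc fun t ht => ?_
            gcongr
            exact C.monotone_K h ht.2
        _ = (∫⁻ t in Ioc (0 : ℝ) 1, ENNReal.ofReal (t⁻¹ * b t ^ q)) ^ (1 / q) * C.K h 1 :=
            setLIntegral_mul_const_rpow hq _ _ (C.K_lt_top h 1).ne
        _ ≤ I ^ (1 / q) * ((m⁻¹) ^ (1 / q) * C.normK 0 q B h) := by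
            gcongr
            · exact lintegral_mono_set Ioc_subset_Ioi_self
            · exact C.K_le_mul_normK hq hB.pos h one_pos hm0.ne' hB_fin.ne
        _ = _ := (mul_assoc _ _ _).symm
    · exact le_rfl
  set M := I ^ (1 / q) + (I ^ (1 / q) * (m⁻¹) ^ (1 / q) + 1) with hM
  have hMtop : M ≠ ∞ := by
    simp only [hM, ne_eq, ENNReal.add_eq_top, not_or]
    exact ⟨hIq, ENNReal.mul_ne_top hIq hmq, ENNReal.one_ne_top⟩
  have hM0 : M ≠ 0 := by simp [hM]
  refine ⟨M.toNNReal, fun f => ?_⟩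
  rw [ENNReal.coe_toNNReal hMtop, ← ENNReal.inv_mul_le_iff hM0 hMtop]
  refine le_sumNorm fun g h e => ?_
  rw [ENNReal.inv_mul_le_iff hM0 hMtop, e, mul_add]
  refine (C.normK_add_le hq hb.measurable g h).trans ?_
  gcongr ?_ + ?_
  · exact (C.normK_le_mul_norm₀ hq hb.pos hb_fin hI0 g).trans
      (by gcongr; exact le_self_add)
  · exact (hKB h).trans (by gcongr; exact le_add_self)

/-- `(X₀,X₁)_{0,q,b;K} ⊆ X₀ + (X₀,X₁)_{0,q,B;K}`: split `f = x + y` nearly optimally for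
`K(f,1)`. -/
theorem exists_sumNorm_le_mul_normK (C : CompatibleCouple X₀ X₁ 𝒳) {q : ℝ} (hq : 1 ≤ q)
    {b B : ℝ → ℝ} (hb : IsSlowlyVarying b) (hB : IsSlowlyVarying B)
    (hb_fin : ∫⁻ t in Ioi (0 : ℝ), ENNReal.ofReal (t⁻¹ * b t ^ q) < ∞)
    (hBb : ∀ x : ℝ, 1 ≤ x → B x = b x) :
    ∃ M : ℝ≥0, ∀ f, sumNorm C.norm₀ (C.normK 0 q B) f ≤ M * C.normK 0 q b f := by
  have hq0 : 0 < q := by linarith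
  set I := ∫⁻ t in Ioi (0 : ℝ), ENNReal.ofReal (t⁻¹ * b t ^ q) with hI
  set m := ∫⁻ t in Ioi (1 : ℝ), ENNReal.ofReal (t⁻¹ * b t ^ q) with hm
  set Q := ∫⁻ t in Ioc (0 : ℝ) 1, ENNReal.ofReal (t⁻¹ * B t ^ q) * ENNReal.ofReal t ^ q with hQ
  have hm0 : 0 < m := hb.setLIntegral_Ioi_pos hq one_pos
  have hmtop : m < ∞ := (lintegral_mono_set (Ioi_subset_Ioi zero_le_one)).trans_lt hb_fin
  have hIq : I ^ (1 / q) ≠ ∞ := ENNReal.rpow_ne_top_of_nonneg (by positivity) hb_fin.ne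
  have hQq : Q ^ (1 / q) ≠ ∞ := ENNReal.rpow_ne_top_of_nonneg (by positivity)
    (hB.setLIntegral_Ioc_mul_rpow_lt_top hq).ne
  have hmq : (m⁻¹) ^ (1 / q) ≠ ∞ :=
    ENNReal.rpow_ne_top_of_nonneg (by positivity) (ENNReal.inv_ne_top.2 hm0.ne')
  have hy : ∀ y, C.normK 0 q B (C.inr y) ≤
      Q ^ (1 / q) * ENNReal.ofReal ‖y‖ + C.normK 0 q b (C.inr y) := by
    intro y
    refine (weightedNorm_le_add_of_eq_on_Ici hq hB.pos hb.pos hBb _).trans ?_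
    gcongr ?_ + ?_
    · rw [← setLIntegral_mul_const_rpow hq _ _ ENNReal.ofReal_ne_top]
      gcongr ?_ ^ _
      refine setLIntegral_mono' measurableSet_Ioc fun t ht => ?_
      rw [mul_assoc, ← ENNReal.mul_rpow_of_nonneg _ _ hq0.le, ← ENNReal.ofReal_mul ht.1.le]
      gcongr
      exact C.K_inr_le y t
    · exact le_rfl
  set M := 1 + I ^ (1 / q) + Q ^ (1 / q) with hM
  have hMtop : M ≠ ∞ := by
    simp only [hM, ne_eq, ENNReal.add_eq_top, not_or]
    exact ⟨⟨ENNReal.one_ne_top, hIq⟩, hQq⟩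
  have hM0 : M ≠ 0 := by simp [hM]
  have key : ∀ f, sumNorm C.norm₀ (C.normK 0 q B) f ≤ C.normK 0 q b f + M * C.K f 1 := by
    intro f
    rw [← tsub_le_iff_left, ← ENNReal.inv_mul_le_iff hM0 hMtop]
    refine C.le_K fun x y e => ?_
    rw [ENNReal.inv_mul_le_iff hM0 hMtop, tsub_le_iff_left]
    have e' : C.inr y = f + C.inl (-x) := by rw [e, inl_neg]; abel
    have h1 : C.normK 0 q b (C.inr y) ≤
        C.normK 0 q b f + I ^ (1 / q) * ENNReal.ofReal ‖x‖ := by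
      rw [e']
      refine (C.normK_add_le hq hb.measurable _ _).trans ?_
      gcongr
      simpa using C.normK_inl_le hq hb.pos (-x)
    have h2 : ENNReal.ofReal ‖x‖ ≤ ENNReal.ofReal (‖x‖ + 1 * ‖y‖) :=
      ENNReal.ofReal_le_ofReal (by linarith [norm_nonneg y])
    have h3 : ENNReal.ofReal ‖y‖ ≤ ENNReal.ofReal (‖x‖ + 1 * ‖y‖) :=
      ENNReal.ofReal_le_ofReal (by linarith [norm_nonneg x])
    set r := ENNReal.ofReal (‖x‖ + 1 * ‖y‖)
    calc sumNorm C.norm₀ (C.normK 0 q B) f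
        ≤ C.norm₀ (C.inl x) + C.normK 0 q B (C.inr y) := sumNorm_le _ _ e
      _ ≤ r + (Q ^ (1 / q) * r + (C.normK 0 q b f + I ^ (1 / q) * r)) := by
          gcongr
          · exact (C.norm₀_inl_le x).trans h2
          · exact (hy y).trans (by
              gcongr
              exact h1.trans (by gcongr))
      _ = C.normK 0 q b f + M * r := by rw [hM]; ring
  have hMM : 1 + M * (m⁻¹) ^ (1 / q) ≠ ∞ := by
    simp only [ne_eq, ENNReal.add_eq_top, not_or]
    exact ⟨ENNReal.one_ne_top, ENNReal.mul_ne_top hMtop hmq⟩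
  refine ⟨(1 + M * (m⁻¹) ^ (1 / q)).toNNReal, fun f => ?_⟩
  rw [ENNReal.coe_toNNReal hMM, add_mul, one_mul, mul_assoc]
  refine (key f).trans ?_
  gcongr
  exact C.K_le_mul_normK hq hb.pos f one_pos hm0.ne' hmtop.ne

end CompatibleCouple

/-! ### Hardy inequalities -/

/-- Jensen's inequality with a weight. -/
theorem lintegral_mul_rpow_le_rpow_mul_lintegral {α : Type*} [MeasurableSpace α] {μ : Measure α}
    {q : ℝ} (hq : 1 ≤ q) {w g : α → ℝ≥0∞} (hw : AEMeasurable w μ) (hg : AEMeasurable g μ) :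
    (∫⁻ a, w a * g a ∂μ) ^ q ≤ (∫⁻ a, w a ∂μ) ^ (q - 1) * ∫⁻ a, w a * g a ^ q ∂μ := by
  rcases hq.eq_or_lt with rfl | hq1
  · simp
  have hq0 : 0 < q := by linarith
  have hpq : (q.conjExponent).HolderConjugate q := (Real.HolderConjugate.conjExponent hq1).symm
  have hp0 : 0 < q.conjExponent := hpq.pos
  have hsum := hpq.inv_add_inv_eq_one
  have h := ENNReal.lintegral_mul_le_Lp_mul_Lq μ hpq (hw.pow_const (q.conjExponent)⁻¹)
    ((hw.pow_const q⁻¹).mul hg)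
  have e1 : ∀ a, ((fun a => w a ^ (q.conjExponent)⁻¹) * ((fun a => w a ^ q⁻¹) * g)) a =
      w a * g a := fun a => by
    simp only [Pi.mul_apply]
    rw [← mul_assoc, ← ENNReal.rpow_add_of_nonneg _ _ (by positivity) (by positivity), hsum,
      ENNReal.rpow_one]
  have e2 : ∀ a, (w a ^ (q.conjExponent)⁻¹) ^ q.conjExponent = w a := fun a => by
    rw [← ENNReal.rpow_mul, inv_mul_cancel₀ hp0.ne', ENNReal.rpow_one]
  have e3 : ∀ a, ((fun a => w a ^ q⁻¹) * g) a ^ q = w a * g a ^ q := fun a => by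
    simp only [Pi.mul_apply]
    rw [ENNReal.mul_rpow_of_nonneg _ _ hq0.le, ← ENNReal.rpow_mul, inv_mul_cancel₀ hq0.ne',
      ENNReal.rpow_one]
  simp only [e1, e2, e3] at h
  refine (ENNReal.rpow_le_rpow h hq0.le).trans_eq ?_
  rw [ENNReal.mul_rpow_of_nonneg _ _ hq0.le, ← ENNReal.rpow_mul, ← ENNReal.rpow_mul,
    one_div_mul_cancel hq0.ne', ENNReal.rpow_one]
  congr 2
  rw [one_div, eq_sub_of_add_eq hsum]
  field_simp

theorem lintegral_mul_lintegral_Iio_swap {μ ν : Measure ℝ} [SFinite μ] [SFinite ν]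
    {a G : ℝ → ℝ≥0∞} (ha : AEMeasurable a μ) (hG : AEMeasurable G ν) :
    ∫⁻ t, a t * ∫⁻ s in Iio t, G s ∂ν ∂μ = ∫⁻ s, G s * ∫⁻ t in Ioi s, a t ∂μ ∂ν := by
  have hT : MeasurableSet {p : ℝ × ℝ | p.2 < p.1} := measurableSet_lt measurable_snd measurable_fst
  have hm : AEMeasurable (Function.uncurry fun t s => (Iio t).indicator (fun s => a t * G s) s)
      (μ.prod ν) := by
    have : (Function.uncurry fun t s => (Iio t).indicator (fun s => a t * G s) s) =
        {p : ℝ × ℝ | p.2 < p.1}.indicator fun p => a p.1 * G p.2 := by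
      ext ⟨t, s⟩
      simp [Function.uncurry, indicator]
    rw [this]
    exact (ha.comp_fst.mul hG.comp_snd).indicator hT
  have h1 : ∀ t, a t * ∫⁻ s in Iio t, G s ∂ν =
      ∫⁻ s, (Iio t).indicator (fun s => a t * G s) s ∂ν := fun t => by
    rw [lintegral_indicator measurableSet_Iio, lintegral_const_mul'' _ hG.restrict]
  have h2 : ∀ s, G s * ∫⁻ t in Ioi s, a t ∂μ =
      ∫⁻ t, (Iio t).indicator (fun s => a t * G s) s ∂μ := fun s => by
    rw [← lintegral_const_mul'' _ ha.restrict, ← lintegral_indicator measurableSet_Ioi]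
    congr 1
    ext t
    simp [indicator, mul_comm]
  simp only [h1, h2]
  exact lintegral_lintegral_swap hm

theorem setLIntegral_Ioc_rpow_sub_one {a δ : ℝ} (ha : 0 ≤ a) (hδ : 0 < δ) :
    ∫⁻ r in Ioc 0 a, ENNReal.ofReal (r ^ (δ - 1)) = ENNReal.ofReal (a ^ δ / δ) := by
  have hi : IntegrableOn (fun r : ℝ => r ^ (δ - 1)) (Ioc 0 a) :=
    (intervalIntegrable_iff_integrableOn_Ioc_of_le ha).1
      (intervalIntegral.intervalIntegrable_rpow' (by linarith))
  rw [← ofReal_integral_eq_lintegral_ofReal hi, ← intervalIntegral.integral_of_le ha,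
    integral_rpow (Or.inl (by linarith))]
  · simp [Real.zero_rpow hδ.ne']
  · filter_upwards [ae_restrict_mem measurableSet_Ioc] with r hr
    exact Real.rpow_nonneg hr.1.le _

theorem setLIntegral_Ioi_rpow_sub_one {a γ : ℝ} (ha : 0 < a) (hγ : γ < 0) :
    ∫⁻ r in Ioi a, ENNReal.ofReal (r ^ (γ - 1)) = ENNReal.ofReal (a ^ γ / (-γ)) := by
  rw [← ofReal_integral_eq_lintegral_ofReal (integrableOn_Ioi_rpow_of_lt (by linarith) ha),
    integral_Ioi_rpow_of_lt (by linarith) ha]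
  · congr 1
    rw [sub_add_cancel, div_neg, neg_div]
  · filter_upwards [ae_restrict_mem measurableSet_Ioi] with r hr
    exact Real.rpow_nonneg (ha.trans hr).le _

/-- `μ` is concentrated on `(0,∞)`, and its tails `V(t) = μ(t,∞)`, `t > 0`, are positive and
finite. -/
structure IsTail (μ : Measure ℝ) (V : ℝ → ℝ) : Prop where
  pos : ∀ t, 0 < t → 0 < V t
  measure_Ioi : ∀ t, 0 < t → μ (Ioi t) = ENNReal.ofReal (V t)
  ae_pos : ∀ᵐ t ∂μ, 0 < t

namespace IsTail

variable {μ : Measure ℝ} {V : ℝ → ℝ}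

theorem antitoneOn (h : IsTail μ V) : AntitoneOn V (Ioi 0) := by
  intro s hs t ht hst
  rw [← ENNReal.ofReal_le_ofReal_iff (h.pos s hs).le, ← h.measure_Ioi s hs, ← h.measure_Ioi t ht]
  exact measure_mono (Ioi_subset_Ioi hst)

theorem aemeasurable (h : IsTail μ V) : AEMeasurable V μ := by
  rw [← Measure.restrict_eq_self_of_ae_mem (s := Ioi (0 : ℝ)) h.ae_pos]
  exact aemeasurable_restrict_of_antitoneOn measurableSet_Ioi h.antitoneOn

/-- The sublevel set is a half-line, open or closed, because `V` decreases. -/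
theorem measure_setOf_lt_le [NullSingletonClass μ] (h : IsTail μ V) (r : ℝ) :
    μ {s | 0 < s ∧ V s < r} ≤ ENNReal.ofReal r := by
  set U := {s | 0 < s ∧ V s < r} with hU
  rcases U.eq_empty_or_nonempty with h0 | hne
  · simp [h0]
  have hbdd : BddBelow U := ⟨0, fun s hs => hs.1.le⟩
  have hup : ∀ n : ℕ, sInf U + ((n : ℝ) + 1)⁻¹ ∈ U := fun n => by
    obtain ⟨s, hs, hlt⟩ := exists_lt_of_csInf_lt hne
      (lt_add_of_pos_right (sInf U) (by positivity : (0 : ℝ) < ((n : ℝ) + 1)⁻¹))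
    have h0 : 0 < sInf U + ((n : ℝ) + 1)⁻¹ := hs.1.trans hlt
    exact ⟨h0, (h.antitoneOn hs.1 h0 hlt.le).trans_lt hs.2⟩
  have hcover : Ioi (sInf U) = ⋃ n : ℕ, Ioi (sInf U + ((n : ℝ) + 1)⁻¹) := by
    ext s
    simp only [mem_Ioi, mem_iUnion]
    refine ⟨fun hs => ?_, fun ⟨n, hn⟩ => lt_trans (lt_add_of_pos_right _ (by positivity)) hn⟩
    obtain ⟨n, hn⟩ := exists_nat_one_div_lt (sub_pos.2 hs)
    refine ⟨n, ?_⟩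
    rw [one_div] at hn
    linarith
  have hmono : Monotone fun n : ℕ => Ioi (sInf U + ((n : ℝ) + 1)⁻¹) := fun m n hmn =>
    Ioi_subset_Ioi (by gcongr)
  calc μ U ≤ μ (Ici (sInf U)) := measure_mono fun s hs => csInf_le hbdd hs
    _ = μ (Ioi (sInf U)) := (measure_congr Ioi_ae_eq_Ici).symm
    _ = ⨆ n : ℕ, μ (Ioi (sInf U + ((n : ℝ) + 1)⁻¹)) := by
        rw [hcover]; exact hmono.measure_iUnion
    _ ≤ ENNReal.ofReal r := iSup_le fun n => by
        rw [h.measure_Ioi _ (hup n).1]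
        exact ENNReal.ofReal_le_ofReal (hup n).2.le

/-- By the layer cake formula, as `μ {V < r⁻¹} ≤ r⁻¹`. -/
theorem setLIntegral_Iio_rpow_le [NullSingletonClass μ] (h : IsTail μ V) {δ : ℝ} (hδ : 0 < δ)
    {t : ℝ} (ht : 0 < t) :
    ∫⁻ s in Iio t, ENNReal.ofReal ((V s)⁻¹ ^ (1 + δ)) ∂μ ≤
      ENNReal.ofReal ((1 + δ) / δ * (V t)⁻¹ ^ δ) := by
  have hVt := h.pos t ht
  have hpos : ∀ᵐ s ∂μ.restrict (Iio t), 0 < s := ae_restrict_of_ae h.ae_pos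
  rw [lintegral_rpow_eq_lintegral_meas_lt_mul _ (p := 1 + δ) (f := fun s => (V s)⁻¹) ?_
    h.aemeasurable.restrict.inv (by linarith)]
  swap
  · filter_upwards [hpos] with s hs using inv_nonneg.2 (h.pos s hs).le
  have hle : ∀ r ∈ Ioi (0 : ℝ),
      μ.restrict (Iio t) {s | r < (V s)⁻¹} * ENNReal.ofReal (r ^ (1 + δ - 1)) ≤
        (Ioc 0 (V t)⁻¹).indicator (fun r => ENNReal.ofReal (r ^ (δ - 1))) r := by
    intro r hr
    have hr : 0 < r := hr
    have hs : μ.restrict (Iio t) {s | r < (V s)⁻¹} = μ {s | 0 < s ∧ s < t ∧ r < (V s)⁻¹} := by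
      rw [Measure.restrict_apply' measurableSet_Iio]
      refine measure_congr ?_
      filter_upwards [h.ae_pos] with s hs
      simp only [inter_def, mem_ofPred_eq, mem_Iio, eq_iff_iff]
      change (r < (V s)⁻¹ ∧ s < t) ↔ (0 < s ∧ s < t ∧ r < (V s)⁻¹)
      tauto
    rw [hs]
    by_cases hrt : r ≤ (V t)⁻¹
    · rw [indicator_of_mem (show r ∈ Ioc 0 (V t)⁻¹ from ⟨hr, hrt⟩)]
      have : μ {s | 0 < s ∧ s < t ∧ r < (V s)⁻¹} ≤ ENNReal.ofReal r⁻¹ := by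
        refine (measure_mono fun s hs => ?_).trans (h.measure_setOf_lt_le r⁻¹)
        exact ⟨hs.1, (lt_inv_comm₀ hr (h.pos s hs.1)).1 hs.2.2⟩
      refine (mul_le_mul_left this _).trans_eq ?_
      rw [← ENNReal.ofReal_mul (by positivity)]
      congr 1
      rw [Real.rpow_sub_one hr.ne', Real.rpow_sub_one hr.ne',
        Real.rpow_one_add' hr.le (by positivity)]
      field_simp
    · have : {s | 0 < s ∧ s < t ∧ r < (V s)⁻¹} = ∅ := by
        ext s
        simp only [mem_ofPred_eq, mem_empty_iff_false, iff_false, not_and, not_lt]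
        intro hs hst
        refine le_trans ?_ (not_le.1 hrt).le
        exact inv_anti₀ hVt (h.antitoneOn hs ht hst.le)
      simp [this]
  refine (mul_le_mul_right (setLIntegral_mono' measurableSet_Ioi hle) _).trans_eq ?_
  rw [setLIntegral_indicator measurableSet_Ioc,
    inter_eq_self_of_subset_left Ioc_subset_Ioi_self, setLIntegral_Ioc_rpow_sub_one
    (inv_nonneg.2 hVt.le) hδ, ← ENNReal.ofReal_mul (by positivity)]
  congr 1
  ring

/-- By the layer cake formula, as `μ {V < r⁻¹} ≤ r⁻¹`. -/
theorem setLIntegral_Ioi_rpow_le [NullSingletonClass μ] (h : IsTail μ V) {γ : ℝ} (hγ : 0 ≤ γ)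
    (hγ1 : γ < 1) {t : ℝ} (ht : 0 < t) :
    ∫⁻ s in Ioi t, ENNReal.ofReal ((V s)⁻¹ ^ γ) ∂μ ≤
      ENNReal.ofReal ((1 - γ)⁻¹ * V t ^ (1 - γ)) := by
  have hVt := h.pos t ht
  rcases hγ.eq_or_lt with rfl | hγ0
  · simp [h.measure_Ioi t ht]
  have hpos : ∀ᵐ s ∂μ.restrict (Ioi t), 0 < s := ae_restrict_of_ae h.ae_pos
  rw [lintegral_rpow_eq_lintegral_meas_lt_mul _ (p := γ) (f := fun s => (V s)⁻¹) ?_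
    h.aemeasurable.restrict.inv hγ0]
  swap
  · filter_upwards [hpos] with s hs using inv_nonneg.2 (h.pos s hs).le
  have hV1 : (0 : ℝ) < 1 - γ := by linarith
  have hnear : ∀ r ∈ Ioc 0 (V t)⁻¹,
      μ.restrict (Ioi t) {s | r < (V s)⁻¹} * ENNReal.ofReal (r ^ (γ - 1)) ≤
        ENNReal.ofReal (V t) * ENNReal.ofReal (r ^ (γ - 1)) := by
    intro r _
    gcongr
    rw [Measure.restrict_apply' measurableSet_Ioi]
    exact (measure_mono inter_subset_right).trans_eq (h.measure_Ioi t ht)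
  have hfar : ∀ r ∈ Ioi (V t)⁻¹,
      μ.restrict (Ioi t) {s | r < (V s)⁻¹} * ENNReal.ofReal (r ^ (γ - 1)) ≤
        ENNReal.ofReal (r ^ (γ - 1 - 1)) := by
    intro r hr
    have hr : 0 < r := (inv_pos.2 hVt).trans hr
    have : μ.restrict (Ioi t) {s | r < (V s)⁻¹} ≤ ENNReal.ofReal r⁻¹ := by
      rw [Measure.restrict_apply' measurableSet_Ioi]
      refine (measure_mono fun s hs => ?_).trans (h.measure_setOf_lt_le r⁻¹)
      have hs0 : 0 < s := ht.trans hs.2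
      exact ⟨hs0, (lt_inv_comm₀ hr (h.pos s hs0)).1 hs.1⟩
    refine (mul_le_mul_left this _).trans_eq ?_
    rw [← ENNReal.ofReal_mul (by positivity), Real.rpow_sub_one hr.ne' (γ - 1)]
    congr 1
    field_simp
  rw [← Ioc_union_Ioi_eq_Ioi (inv_nonneg.2 hVt.le)]
  refine (mul_le_mul_right ((lintegral_union_le _ _ _).trans (add_le_add
    (setLIntegral_mono' measurableSet_Ioc hnear) (setLIntegral_mono' measurableSet_Ioi hfar)))
    _).trans_eq ?_
  rw [lintegral_const_mul _ (by fun_prop), setLIntegral_Ioc_rpow_sub_one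
    (inv_nonneg.2 hVt.le) hγ0, setLIntegral_Ioi_rpow_sub_one (inv_pos.2 hVt) (by linarith),
    ← ENNReal.ofReal_mul hVt.le, neg_sub, ← ENNReal.ofReal_add (by positivity)
    (by positivity), ← ENNReal.ofReal_mul hγ]
  congr 1
  have e1 : (V t)⁻¹ ^ γ = V t ^ (1 - γ) / V t := by
    rw [Real.inv_rpow hVt.le, Real.rpow_sub hVt, Real.rpow_one]
    field_simp
  have e2 : (V t)⁻¹ ^ (γ - 1) = V t ^ (1 - γ) := by
    rw [Real.inv_rpow hVt.le, ← Real.rpow_neg hVt.le, neg_sub]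
  rw [e1, e2]
  field_simp
  ring

/-- Hardy's inequality relative to `μ`. By Jensen's inequality with the weight `V^{-1-δ}`,
`(∫_{s<t} ψ dμ)^q` is at most a multiple of
`V(t)^{-δ(q-1)} ∫_{s<t} V^{δ(q-1)-1} (V ψ)^q dμ`; integrate in `t` and use Tonelli's theorem. -/
theorem exists_hardy [SFinite μ] [NullSingletonClass μ] (h : IsTail μ V) {q : ℝ} (hq : 1 ≤ q) :
    ∃ C : ℝ, 0 < C ∧ ∀ ψ : ℝ → ℝ≥0∞, AEMeasurable ψ μ →
      ∫⁻ t, (∫⁻ s in Iio t, ψ s ∂μ) ^ q ∂μ ≤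
        ENNReal.ofReal C * ∫⁻ s, (ENNReal.ofReal (V s) * ψ s) ^ q ∂μ := by
  have hq0 : 0 < q := by linarith
  -- any `δ > 0` with `δ (q - 1) < 1` works
  set δ : ℝ := (2 * q)⁻¹ with hδdef
  have hδ : 0 < δ := by positivity
  set γ : ℝ := δ * (q - 1) with hγdef
  have hγ : 0 ≤ γ := mul_nonneg hδ.le (by linarith)
  have hγ1 : γ < 1 := by
    rw [hγdef, hδdef, inv_mul_lt_iff₀ (by positivity)]
    linarith
  have hV1 : 0 < 1 - γ := by linarith
  set C₁ : ℝ := (1 + δ) / δ with hC₁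
  have hC₁0 : 0 < C₁ := by positivity
  refine ⟨C₁ ^ (q - 1) * (1 - γ)⁻¹, by positivity, fun ψ hψ => ?_⟩
  set w : ℝ → ℝ≥0∞ := fun s => ENNReal.ofReal ((V s)⁻¹ ^ (1 + δ)) with hw
  have hwm : AEMeasurable w μ := (h.aemeasurable.inv.pow_const _).ennreal_ofReal
  set G : ℝ → ℝ≥0∞ := fun s => ENNReal.ofReal ((V s)⁻¹ ^ (1 - γ)) *
    (ENNReal.ofReal (V s) * ψ s) ^ q with hG
  have hGm : AEMeasurable G μ := ((h.aemeasurable.inv.pow_const _).ennreal_ofReal).mul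
    ((h.aemeasurable.ennreal_ofReal.mul hψ).pow_const q)
  have step : ∀ᵐ t ∂μ, (∫⁻ s in Iio t, ψ s ∂μ) ^ q ≤
      ENNReal.ofReal (C₁ ^ (q - 1) * (V t)⁻¹ ^ γ) * ∫⁻ s in Iio t, G s ∂μ := by
    filter_upwards [h.ae_pos] with t ht
    have hVt := h.pos t ht
    have e1 : ∫⁻ s in Iio t, ψ s ∂μ = ∫⁻ s in Iio t, w s * ((w s)⁻¹ * ψ s) ∂μ := by
      refine lintegral_congr_ae (ae_restrict_of_ae ?_)
      filter_upwards [h.ae_pos] with s hs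
      have hVs := h.pos s hs
      rw [← mul_assoc, ENNReal.mul_inv_cancel (ENNReal.ofReal_pos.2 (by positivity)).ne'
        ENNReal.ofReal_ne_top, one_mul]
    have e2 : ∫⁻ s in Iio t, w s * ((w s)⁻¹ * ψ s) ^ q ∂μ = ∫⁻ s in Iio t, G s ∂μ := by
      refine lintegral_congr_ae (ae_restrict_of_ae ?_)
      filter_upwards [h.ae_pos] with s hs
      have hVs := h.pos s hs
      simp only [hw, hG]
      rw [ENNReal.mul_rpow_of_nonneg _ _ hq0.le, ENNReal.mul_rpow_of_nonneg _ _ hq0.le,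
        ← mul_assoc, ← mul_assoc, ← ENNReal.ofReal_inv_of_pos (by positivity),
        ENNReal.ofReal_rpow_of_nonneg (by positivity) hq0.le,
        ENNReal.ofReal_rpow_of_nonneg hVs.le hq0.le, ← ENNReal.ofReal_mul (by positivity),
        ← ENNReal.ofReal_mul (by positivity)]
      congr 2
      rw [Real.inv_rpow hVs.le, Real.inv_rpow hVs.le, inv_inv, ← Real.rpow_mul hVs.le,
        ← Real.rpow_neg hVs.le, ← Real.rpow_neg hVs.le, ← Real.rpow_add hVs, ← Real.rpow_add hVs]
      congr 1
      rw [hγdef]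
      ring
    rw [e1]
    refine (lintegral_mul_rpow_le_rpow_mul_lintegral hq hwm.restrict
      (hwm.inv.mul hψ).restrict).trans ?_
    simp only [Pi.mul_apply, Pi.inv_apply]
    rw [e2]
    gcongr
    refine (ENNReal.rpow_le_rpow (h.setLIntegral_Iio_rpow_le hδ ht) (by linarith)).trans_eq ?_
    rw [ENNReal.ofReal_rpow_of_nonneg (by positivity) (by linarith),
      Real.mul_rpow (by positivity) (by positivity), ← Real.rpow_mul (by positivity)]
  refine (lintegral_mono_ae step).trans ?_
  have ham : AEMeasurable (fun t => ENNReal.ofReal (C₁ ^ (q - 1) * (V t)⁻¹ ^ γ)) μ :=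
    ((h.aemeasurable.inv.pow_const _).const_mul _).ennreal_ofReal
  rw [lintegral_mul_lintegral_Iio_swap ham hGm,
    ← lintegral_const_mul' _ _ ENNReal.ofReal_ne_top]
  refine lintegral_mono_ae ?_
  filter_upwards [h.ae_pos] with s hs
  have hVs := h.pos s hs
  have e3 : ∫⁻ t in Ioi s, ENNReal.ofReal (C₁ ^ (q - 1) * (V t)⁻¹ ^ γ) ∂μ ≤
      ENNReal.ofReal (C₁ ^ (q - 1) * ((1 - γ)⁻¹ * V s ^ (1 - γ))) := by
    simp only [ENNReal.ofReal_mul (by positivity : 0 ≤ C₁ ^ (q - 1))]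
    rw [lintegral_const_mul' _ _ ENNReal.ofReal_ne_top]
    gcongr
    exact h.setLIntegral_Ioi_rpow_le hγ hγ1 hs
  refine (mul_le_mul_right e3 _).trans_eq ?_
  simp only [hG]
  rw [mul_right_comm, ← ENNReal.ofReal_mul (by positivity)]
  congr 2
  rw [Real.inv_rpow hVs.le]
  have := (Real.rpow_pos_of_pos hVs (1 - γ)).ne'
  field_simp

end IsTail

/-- Hardy's inequality for the tail average, with a slowly varying weight. It is Jensen's
inequality with the weight `(t/s)^{1/2}`, as `t^{1/2} b(t) ≲ s^{1/2} b(s)` for `t ≤ s`. -/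
theorem IsSlowlyVarying.exists_hardy_tail {b : ℝ → ℝ} (hb : IsSlowlyVarying b) {q : ℝ}
    (hq : 1 ≤ q) :
    ∃ C : ℝ, 0 < C ∧ ∀ φ : ℝ → ℝ≥0∞, AEMeasurable φ (volume.restrict (Ioi 0)) →
      ∫⁻ t in Ioi (0 : ℝ), ENNReal.ofReal (t⁻¹ * b t ^ q) *
          (∫⁻ s in Ioi t, ENNReal.ofReal (t / s * s⁻¹) * φ s) ^ q ≤
        ENNReal.ofReal C * ∫⁻ s in Ioi (0 : ℝ), ENNReal.ofReal (s⁻¹ * b s ^ q) * φ s ^ q := by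
  have hq0 : 0 < q := by linarith
  obtain ⟨D, hD, hbD⟩ := hb.rpow_mul_le (half_pos one_pos)
  refine ⟨2 ^ (q - 1) * D ^ q * 2, by positivity, fun φ hφ => ?_⟩
  have hbm := hb.aemeasurable_inv_mul_rpow q
  -- after Jensen, the kernel `t⁻¹ (t/s)^{1/2} s⁻¹ b(s)^q` separates the variables
  set G : ℝ → ℝ≥0∞ := fun s => ENNReal.ofReal (s ^ (-(1 / 2) : ℝ)) *
    (ENNReal.ofReal (s⁻¹ * b s ^ q) * φ s ^ q) with hG
  have hGm : AEMeasurable G (volume.restrict (Ioi 0)) :=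
    (Measurable.aemeasurable (by fun_prop)).mul (hbm.ennreal_ofReal.mul (hφ.pow_const q))
  have step : ∀ t ∈ Ioi (0 : ℝ), ENNReal.ofReal (t⁻¹ * b t ^ q) *
      (∫⁻ s in Ioi t, ENNReal.ofReal (t / s * s⁻¹) * φ s) ^ q ≤
        ENNReal.ofReal (2 ^ (q - 1) * D ^ q * t ^ (1 / 2 - 1 : ℝ)) *
          ∫⁻ s in Ioi t, G s := by
    intro t ht
    have ht : 0 < t := ht
    have hbt := hb.pos t ht
    set w : ℝ → ℝ≥0∞ := fun s => ENNReal.ofReal (t ^ (1 / 2 : ℝ)) *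
      ENNReal.ofReal (s ^ (-(1 / 2) - 1 : ℝ)) with hw
    set g : ℝ → ℝ≥0∞ := fun s => ENNReal.ofReal ((t / s) ^ (1 / 2 : ℝ)) * φ s with hg
    have hφt : AEMeasurable φ (volume.restrict (Ioi t)) :=
      hφ.mono_measure (Measure.restrict_mono (Ioi_subset_Ioi ht.le) le_rfl)
    have e1 : ∫⁻ s in Ioi t, ENNReal.ofReal (t / s * s⁻¹) * φ s = ∫⁻ s in Ioi t, w s * g s := by
      refine setLIntegral_congr_fun measurableSet_Ioi fun s hs => ?_
      have hs : 0 < s := ht.trans hs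
      simp only [hw, hg]
      rw [← mul_assoc, ← ENNReal.ofReal_mul (by positivity), ← ENNReal.ofReal_mul (by positivity)]
      congr 2
      rw [Real.div_rpow ht.le hs.le, Real.rpow_sub_one hs.ne', Real.rpow_neg hs.le]
      have h1 : t = t ^ (1 / 2 : ℝ) * t ^ (1 / 2 : ℝ) := by
        rw [← Real.rpow_add ht]; norm_num
      have h2 : s = s ^ (1 / 2 : ℝ) * s ^ (1 / 2 : ℝ) := by
        rw [← Real.rpow_add hs]; norm_num
      have h3 := (Real.rpow_pos_of_pos hs (1 / 2)).ne'
      calc t / s * s⁻¹ = (t ^ (1 / 2 : ℝ) * t ^ (1 / 2 : ℝ)) /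
            (s ^ (1 / 2 : ℝ) * s ^ (1 / 2 : ℝ)) * s⁻¹ := by rw [← h1, ← h2]
        _ = _ := by field_simp
    have e2 : ∫⁻ s in Ioi t, w s = ENNReal.ofReal 2 := by
      simp only [hw]
      rw [lintegral_const_mul' _ _ ENNReal.ofReal_ne_top,
        setLIntegral_Ioi_rpow_sub_one ht (by norm_num), ← ENNReal.ofReal_mul (by positivity)]
      congr 1
      rw [Real.rpow_neg ht.le]
      have h3 := (Real.rpow_pos_of_pos ht (1 / 2)).ne'
      field_simp
    rw [e1]
    refine (mul_le_mul_right (lintegral_mul_rpow_le_rpow_mul_lintegral hq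
      (Measurable.aemeasurable (by fun_prop))
      ((Measurable.aemeasurable (by fun_prop)).mul hφt)) _).trans ?_
    rw [e2, ENNReal.ofReal_rpow_of_nonneg zero_le_two (by linarith), ← mul_assoc,
      ← ENNReal.ofReal_mul (by positivity), ← lintegral_const_mul' _ _ ENNReal.ofReal_ne_top,
      ← lintegral_const_mul' _ _ ENNReal.ofReal_ne_top]
    refine setLIntegral_mono' measurableSet_Ioi fun s hs => ?_
    have hts : t ≤ s := le_of_lt hs
    have hs : 0 < s := ht.trans hs
    have hbs := hb.pos s hs
    simp only [hw, hG, Pi.mul_apply]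
    rw [ENNReal.mul_rpow_of_nonneg _ _ hq0.le, ENNReal.ofReal_rpow_of_nonneg (by positivity) hq0.le]
    simp only [← mul_assoc]
    gcongr ?_ * _
    rw [← ENNReal.ofReal_mul (by positivity), ← ENNReal.ofReal_mul (by positivity),
      ← ENNReal.ofReal_mul (by positivity), ← ENNReal.ofReal_mul (by positivity),
      ← ENNReal.ofReal_mul (by positivity)]
    apply ENNReal.ofReal_le_ofReal
    have key : (t / s) ^ (1 / 2 : ℝ) * b t ≤ D * b s := by
      rw [Real.div_rpow ht.le hs.le, div_mul_eq_mul_div, div_le_iff₀ (by positivity)]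
      exact (hbD t s ht hts).trans_eq (by ring)
    have keyq : ((t / s) ^ (1 / 2 : ℝ)) ^ q * b t ^ q ≤ D ^ q * b s ^ q := by
      rw [← Real.mul_rpow (by positivity) hbt.le, ← Real.mul_rpow hD.le hbs.le]
      exact Real.rpow_le_rpow (by positivity) key hq0.le
    calc t⁻¹ * b t ^ q * 2 ^ (q - 1) * t ^ (1 / 2 : ℝ) * s ^ (-(1 / 2) - 1 : ℝ) *
          ((t / s) ^ (1 / 2 : ℝ)) ^ q
        = (t⁻¹ * 2 ^ (q - 1) * t ^ (1 / 2 : ℝ) * s ^ (-(1 / 2) - 1 : ℝ)) *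
          (((t / s) ^ (1 / 2 : ℝ)) ^ q * b t ^ q) := by ring
      _ ≤ (t⁻¹ * 2 ^ (q - 1) * t ^ (1 / 2 : ℝ) * s ^ (-(1 / 2) - 1 : ℝ)) *
          (D ^ q * b s ^ q) := by gcongr
      _ = _ := by
        rw [Real.rpow_sub_one hs.ne', Real.rpow_sub_one ht.ne']
        field_simp
  refine (setLIntegral_mono' measurableSet_Ioi step).trans ?_
  -- Tonelli's theorem, on the triangle `0 < t < s`
  have swap := lintegral_mul_lintegral_Iio_swap (μ := volume.restrict (Ioi (0 : ℝ)))
    (ν := volume.restrict (Ioi (0 : ℝ))) hGm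
    (G := fun t : ℝ => ENNReal.ofReal (2 ^ (q - 1) * D ^ q * t ^ (1 / 2 - 1 : ℝ)))
    (Measurable.aemeasurable (by fun_prop))
  have e3 : ∫⁻ t in Ioi (0 : ℝ), ENNReal.ofReal (2 ^ (q - 1) * D ^ q * t ^ (1 / 2 - 1 : ℝ)) *
      ∫⁻ s in Ioi t, G s = ∫⁻ t in Ioi (0 : ℝ),
        ENNReal.ofReal (2 ^ (q - 1) * D ^ q * t ^ (1 / 2 - 1 : ℝ)) *
          ∫⁻ s in Ioi t, G s ∂(volume.restrict (Ioi (0 : ℝ))) := by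
    refine setLIntegral_congr_fun measurableSet_Ioi fun t ht => ?_
    rw [Measure.restrict_restrict measurableSet_Ioi,
      inter_eq_self_of_subset_left (Ioi_subset_Ioi (le_of_lt ht))]
  rw [e3, ← swap, ← lintegral_const_mul' _ _ ENNReal.ofReal_ne_top]
  refine setLIntegral_mono' measurableSet_Ioi fun s hs => ?_
  have hs : 0 < s := hs
  have hsub : Iio s ∩ Ioi 0 ⊆ Ioc 0 s := fun t ht => ⟨ht.2, le_of_lt ht.1⟩
  rw [Measure.restrict_restrict measurableSet_Iio]
  refine (mul_le_mul_right (lintegral_mono_set hsub) _).trans_eq ?_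
  simp only [ENNReal.ofReal_mul (by positivity : 0 ≤ 2 ^ (q - 1) * D ^ q)]
  rw [lintegral_const_mul' _ _ ENNReal.ofReal_ne_top,
    setLIntegral_Ioc_rpow_sub_one hs.le (by norm_num)]
  simp only [hG]
  rw [mul_comm, ← mul_assoc, ← ENNReal.ofReal_mul (by positivity),
    ← ENNReal.ofReal_mul (by positivity)]
  congr 2
  rw [Real.rpow_neg hs.le]
  have h3 := (Real.rpow_pos_of_pos hs (1 / 2)).ne'
  field_simp
  exact ENNReal.ofReal_mul (by positivity)

/-! ### The tail function of a slowly varying weight -/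

namespace IsSlowlyVarying

variable {B : ℝ → ℝ} {q : ℝ}

theorem ofReal_integral_Ioi (hB : IsSlowlyVarying B) {t : ℝ} (ht : 0 < t)
    (hfin : ∫⁻ s in Ioi t, ENNReal.ofReal (s⁻¹ * B s ^ q) < ∞) :
    IntegrableOn (fun s => s⁻¹ * B s ^ q) (Ioi t) ∧
      ENNReal.ofReal (∫ s in Ioi t, s⁻¹ * B s ^ q) =
        ∫⁻ s in Ioi t, ENNReal.ofReal (s⁻¹ * B s ^ q) := by
  have h0 : 0 ≤ᵐ[volume.restrict (Ioi t)] fun s => s⁻¹ * B s ^ q := by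
    filter_upwards [ae_restrict_mem measurableSet_Ioi] with s hs
    have hs0 : 0 < s := ht.trans hs
    have := hB.pos s hs0
    change 0 ≤ s⁻¹ * B s ^ q
    positivity
  have hm : AEMeasurable (fun s => s⁻¹ * B s ^ q) (volume.restrict (Ioi t)) :=
    (hB.aemeasurable_inv_mul_rpow q).mono_measure
      (Measure.restrict_mono (Ioi_subset_Ioi ht.le) le_rfl)
  have hi : IntegrableOn (fun s => s⁻¹ * B s ^ q) (Ioi t) :=
    ⟨hm.aestronglyMeasurable, (hasFiniteIntegral_iff_ofReal h0).2 hfin⟩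
  exact ⟨hi, ofReal_integral_eq_lintegral_ofReal hi h0⟩

theorem isTail (hB : IsSlowlyVarying B) (hq : 1 ≤ q)
    (hfin : ∫⁻ s in Ioi (1 : ℝ), ENNReal.ofReal (s⁻¹ * B s ^ q) < ∞) :
    IsTail ((volume.restrict (Ioi 0)).withDensity fun s => ENNReal.ofReal (s⁻¹ * B s ^ q))
      fun t => ∫ s in Ioi t, s⁻¹ * B s ^ q where
  pos t ht := by
    rw [← ENNReal.ofReal_pos, (hB.ofReal_integral_Ioi ht (hB.setLIntegral_Ioi_lt_top hq hfin ht)).2]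
    exact hB.setLIntegral_Ioi_pos hq ht
  measure_Ioi t ht := by
    rw [(hB.ofReal_integral_Ioi ht (hB.setLIntegral_Ioi_lt_top hq hfin ht)).2,
      withDensity_apply _ measurableSet_Ioi, Measure.restrict_restrict measurableSet_Ioi,
      inter_eq_self_of_subset_left (Ioi_subset_Ioi ht.le)]
  ae_pos := (withDensity_absolutelyContinuous _ _).ae_le (ae_restrict_mem measurableSet_Ioi)

theorem exists_mul_rpow_le_integral (hB : IsSlowlyVarying B) (hq : 1 ≤ q)
    (hfin : ∫⁻ s in Ioi (1 : ℝ), ENNReal.ofReal (s⁻¹ * B s ^ q) < ∞) :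
    ∃ c : ℝ, 0 < c ∧ ∀ t, 0 < t → c * B t ^ q ≤ ∫ s in Ioi t, s⁻¹ * B s ^ q := by
  obtain ⟨c, hc, h⟩ := hB.exists_mul_rpow_le_setLIntegral hq
  refine ⟨c, hc, fun t ht => ?_⟩
  rw [← ENNReal.ofReal_le_ofReal_iff ((hB.isTail hq hfin).pos t ht).le,
    (hB.ofReal_integral_Ioi ht (hB.setLIntegral_Ioi_lt_top hq hfin ht)).2]
  exact h t ht

end IsSlowlyVarying

/-! ### From `J` to `K` -/

namespace CompatibleCouple

variable {X₀ X₁ 𝒳 : Type*}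
  [NormedAddCommGroup X₀] [NormedSpace ℝ X₀] [NormedAddCommGroup X₁] [NormedSpace ℝ X₁]
  [AddCommGroup 𝒳] [Module ℝ 𝒳] [TopologicalSpace 𝒳] [IsTopologicalAddGroup 𝒳]
  [ContinuousSMul ℝ 𝒳] [T2Space 𝒳]

theorem aemeasurable_J (C : CompatibleCouple X₀ X₁ 𝒳) {u : ℝ → C.Inter}
    (hu : AEStronglyMeasurable u (volume.restrict (Ioi 0))) :
    AEMeasurable (fun t => C.J (u t) t) (volume.restrict (Ioi 0)) := by
  have h0 : AEStronglyMeasurable (fun t => (u t).1.1) (volume.restrict (Ioi 0)) :=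
    (continuous_fst.comp continuous_subtype_val).comp_aestronglyMeasurable hu
  have h1 : AEStronglyMeasurable (fun t => (u t).1.2) (volume.restrict (Ioi 0)) :=
    (continuous_snd.comp continuous_subtype_val).comp_aestronglyMeasurable hu
  exact (h0.norm.aemeasurable.max (aemeasurable_id.mul h1.norm.aemeasurable)).ennreal_ofReal

/-- `K(f,t) ≤ ∫_0^∞ min(1,t/s) J(u(s),s) ds/s`: integrate `u` over `(0,t]` in `X₀` and over
`(t,∞)` in `X₁`. -/
theorem Represents.K_le [CompleteSpace X₀] [CompleteSpace X₁] {C : CompatibleCouple X₀ X₁ 𝒳}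
    {u : ℝ → C.Inter} {f : C.Sum} (h : C.Represents u f) {t : ℝ} (ht : 0 < t) :
    C.K f t ≤ (∫⁻ s in Ioc 0 t, ENNReal.ofReal s⁻¹ * C.J (u s) s) +
      ENNReal.ofReal t * ∫⁻ s in Ioi t, ENNReal.ofReal (s⁻¹ * s⁻¹) * C.J (u s) s := by
  by_cases htop : (∫⁻ s in Ioc 0 t, ENNReal.ofReal s⁻¹ * C.J (u s) s) +
      ENNReal.ofReal t * ∫⁻ s in Ioi t, ENNReal.ofReal (s⁻¹ * s⁻¹) * C.J (u s) s = ∞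
  · simp [htop]
  obtain ⟨hP, hQ⟩ := ENNReal.add_ne_top.1 htop
  have hQ : ∫⁻ s in Ioi t, ENNReal.ofReal (s⁻¹ * s⁻¹) * C.J (u s) s ≠ ∞ := fun e => by
    rw [e, ENNReal.mul_top (ENNReal.ofReal_pos.2 ht).ne'] at hQ
    exact hQ rfl
  have hsub0 : Ioc 0 t ⊆ Ioi 0 := Ioc_subset_Ioi_self
  have hsub1 : Ioi t ⊆ Ioi 0 := Ioi_subset_Ioi ht.le
  have m0 : AEStronglyMeasurable (fun s => s⁻¹ • (u s).1.1) (volume.restrict (Ioc 0 t)) :=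
    (Measurable.aestronglyMeasurable (by fun_prop)).smul
      ((continuous_fst.comp continuous_subtype_val).comp_aestronglyMeasurable
        (h.stronglyMeasurable.mono_set hsub0))
  have m1 : AEStronglyMeasurable (fun s => s⁻¹ • (u s).1.2) (volume.restrict (Ioi t)) :=
    (Measurable.aestronglyMeasurable (by fun_prop)).smul
      ((continuous_snd.comp continuous_subtype_val).comp_aestronglyMeasurable
        (h.stronglyMeasurable.mono_set hsub1))
  have b0 : ∫⁻ s in Ioc 0 t, ‖s⁻¹ • (u s).1.1‖ₑ ≤
      ∫⁻ s in Ioc 0 t, ENNReal.ofReal s⁻¹ * C.J (u s) s := by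
    refine setLIntegral_mono' measurableSet_Ioc fun s hs => ?_
    have hs : 0 < s := hs.1
    rw [← ofReal_norm, norm_smul, Real.norm_of_nonneg (by positivity),
      ENNReal.ofReal_mul (by positivity)]
    gcongr
    exact ENNReal.ofReal_le_ofReal (le_max_left _ _)
  have b1 : ∫⁻ s in Ioi t, ‖s⁻¹ • (u s).1.2‖ₑ ≤
      ∫⁻ s in Ioi t, ENNReal.ofReal (s⁻¹ * s⁻¹) * C.J (u s) s := by
    refine setLIntegral_mono' measurableSet_Ioi fun s hs => ?_
    have hs : 0 < s := ht.trans hs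
    rw [← ofReal_norm, norm_smul, Real.norm_of_nonneg (by positivity), J,
      ← ENNReal.ofReal_mul (by positivity)]
    apply ENNReal.ofReal_le_ofReal
    calc s⁻¹ * ‖(u s).1.2‖ = s⁻¹ * s⁻¹ * (s * ‖(u s).1.2‖) := by field_simp
      _ ≤ _ := by gcongr; exact le_max_right _ _
  have i0 : IntegrableOn (fun s => s⁻¹ • (u s).1.1) (Ioc 0 t) := ⟨m0, b0.trans_lt hP.lt_top⟩
  have i1 : IntegrableOn (fun s => s⁻¹ • (u s).1.2) (Ioi t) := ⟨m1, b1.trans_lt hQ.lt_top⟩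
  have e : f = C.inl (∫ s in Ioc 0 t, s⁻¹ • (u s).1.1) +
      C.inr (∫ s in Ioi t, s⁻¹ • (u s).1.2) := by
    rw [← h.integral_eq, ← inlL_apply, ← inrL_apply, ← C.inlL.integral_comp_comm i0,
      ← C.inrL.integral_comp_comm i1, ← Ioc_union_Ioi_eq_Ioi ht.le,
      setIntegral_union (Ioc_disjoint_Ioi le_rfl) measurableSet_Ioi
        (h.integrable.mono_set hsub0) (h.integrable.mono_set hsub1)]
    congr 1
    · simp only [map_smul, inlL_apply]
    · simp only [map_smul, inrL_apply, inl_fst_eq_inr_snd]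
  refine (C.K_le e t).trans ?_
  rw [ENNReal.ofReal_add (norm_nonneg _) (by positivity), ENNReal.ofReal_mul ht.le,
    ofReal_norm, ofReal_norm]
  gcongr
  · exact (enorm_integral_le_lintegral_enorm _).trans b0
  · exact (enorm_integral_le_lintegral_enorm _).trans b1

/-- `(X₀,X₁)_{0,q,A;J} ⊆ (X₀,X₁)_{0,q,B;K}`, by the two Hardy inequalities. -/
theorem exists_normK_le_mul_normJ [CompleteSpace X₀] [CompleteSpace X₁]
    (C : CompatibleCouple X₀ X₁ 𝒳) {q : ℝ} (hq : 1 ≤ q) {A B : ℝ → ℝ} (hB : IsSlowlyVarying B)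
    (hfin : ∫⁻ s in Ioi (1 : ℝ), ENNReal.ofReal (s⁻¹ * B s ^ q) < ∞)
    (hA : ∀ x : ℝ, 0 < x → A x = B x ^ (-(q - 1)) * ∫ t in Ioi x, t⁻¹ * B t ^ q) :
    ∃ M : ℝ≥0, ∀ f, C.normK 0 q B f ≤ M * C.normJ 0 q A f := by
  have hq0 : 0 < q := by linarith
  have hT := hB.isTail hq hfin
  set V : ℝ → ℝ := fun t => ∫ s in Ioi t, s⁻¹ * B s ^ q with hV
  set ρ : ℝ → ℝ≥0∞ := fun s => ENNReal.ofReal (s⁻¹ * B s ^ q) with hρ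
  have hρm : AEMeasurable ρ (volume.restrict (Ioi 0)) :=
    (hB.aemeasurable_inv_mul_rpow q).ennreal_ofReal
  set μ := (volume.restrict (Ioi (0 : ℝ))).withDensity ρ with hμ
  obtain ⟨C₁, hC₁, hardy⟩ := hT.exists_hardy hq
  obtain ⟨C₂, hC₂, hardy'⟩ := hB.exists_hardy_tail hq
  obtain ⟨c, hc, hcB⟩ := hB.exists_mul_rpow_le_integral hq hfin
  have hApos : ∀ t, 0 < t → 0 < A t := fun t ht => by
    rw [hA t ht]
    exact mul_pos (Real.rpow_pos_of_pos (hB.pos t ht) _) (hT.pos t ht)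
  have hBA : ∀ t, 0 < t → B t ≤ c⁻¹ * A t := fun t ht => by
    have hBt := hB.pos t ht
    rw [hA t ht, inv_mul_eq_div, le_div_iff₀ hc]
    calc B t * c = B t ^ (-(q - 1)) * (c * B t ^ q) := by
          rw [mul_left_comm, ← Real.rpow_add hBt, neg_sub, sub_add_cancel, Real.rpow_one, mul_comm]
      _ ≤ _ := by gcongr; exact hcB t ht
  set M : ℝ≥0∞ := ENNReal.ofReal C₁ ^ (1 / q) +
    ENNReal.ofReal C₂ ^ (1 / q) * ENNReal.ofReal c⁻¹ with hM
  have hMtop : M ≠ ∞ := by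
    simp only [hM, ne_eq, ENNReal.add_eq_top, not_or]
    exact ⟨ENNReal.rpow_ne_top_of_nonneg (by positivity) ENNReal.ofReal_ne_top,
      ENNReal.mul_ne_top (ENNReal.rpow_ne_top_of_nonneg (by positivity) ENNReal.ofReal_ne_top)
        ENNReal.ofReal_ne_top⟩
  have hM0 : M ≠ 0 := by
    have : 0 < ENNReal.ofReal C₁ ^ (1 / q) :=
      ENNReal.rpow_pos (ENNReal.ofReal_pos.2 hC₁) ENNReal.ofReal_ne_top
    exact (this.trans_le le_self_add).ne'
  refine ⟨M.toNNReal, fun f => ?_⟩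
  rw [ENNReal.coe_toNNReal hMtop, ← ENNReal.inv_mul_le_iff hM0 hMtop]
  refine le_iInf fun u => le_iInf fun hu => ?_
  rw [ENNReal.inv_mul_le_iff hM0 hMtop]
  set φ : ℝ → ℝ≥0∞ := fun t => C.J (u t) t with hφ
  have hφm : AEMeasurable φ (volume.restrict (Ioi 0)) := C.aemeasurable_J hu.stronglyMeasurable
  set P : ℝ → ℝ≥0∞ := fun t => ∫⁻ s in Ioc 0 t, ENNReal.ofReal s⁻¹ * φ s with hP
  set Q : ℝ → ℝ≥0∞ := fun t =>
    ENNReal.ofReal t * ∫⁻ s in Ioi t, ENNReal.ofReal (s⁻¹ * s⁻¹) * φ s with hQ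
  have hPm : Measurable P :=
    Monotone.measurable fun a b hab => lintegral_mono_set (Ioc_subset_Ioc_right hab)
  have hQm : Measurable Q := by
    have : Antitone fun t : ℝ => ∫⁻ s in Ioi t, ENNReal.ofReal (s⁻¹ * s⁻¹) * φ s :=
      fun a b hab => lintegral_mono_set (Ioi_subset_Ioi hab)
    exact ENNReal.measurable_ofReal.mul this.measurable
  have hPle : weightedNorm 0 q B P ≤ ENNReal.ofReal C₁ ^ (1 / q) * weightedNorm 0 q A φ := by
    rw [weightedNorm_eq hq hB.pos, weightedNorm_eq hq hApos,
      ← ENNReal.mul_rpow_of_nonneg _ _ (by positivity)]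
    gcongr ?_ ^ _
    set ψ : ℝ → ℝ≥0∞ := fun s => ENNReal.ofReal (B s ^ q)⁻¹ * φ s with hψ
    have hψm : AEMeasurable ψ (volume.restrict (Ioi 0)) :=
      (hB.measurable.pow_const q).inv.ennreal_ofReal.mul hφm
    have hρtop : ∀ s : Set ℝ, ∀ᵐ x ∂(volume.restrict (Ioi (0 : ℝ))).restrict s, ρ x < ∞ :=
      fun s => Filter.Eventually.of_forall fun x => ENNReal.ofReal_lt_top
    have e1 : ∀ t, ∫⁻ s in Iio t, ψ s ∂μ = P t := fun t => by
      rw [hμ, setLIntegral_withDensity_eq_setLIntegral_mul_non_measurable₀ _ hρm.restrict ψ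
        measurableSet_Iio (hρtop _), Measure.restrict_restrict measurableSet_Iio, hP]
      have : Iio t ∩ Ioi 0 = Ioo 0 t := by ext s; simp [and_comm]
      rw [this]
      simp only
      rw [← setLIntegral_congr Ioo_ae_eq_Ioc]
      refine setLIntegral_congr_fun measurableSet_Ioo fun s hs => ?_
      have hs0 : 0 < s := hs.1
      have hBs := hB.pos s hs0
      simp only [Pi.mul_apply, hρ, hψ]
      rw [← mul_assoc, ← ENNReal.ofReal_mul (by positivity)]
      congr 2
      field_simp
    have e2 : ∫⁻ t, P t ^ q ∂μ = ∫⁻ t in Ioi 0, ρ t * P t ^ q := by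
      rw [hμ, lintegral_withDensity_eq_lintegral_mul_non_measurable₀ _ hρm
        (Filter.Eventually.of_forall fun x => ENNReal.ofReal_lt_top)]
      rfl
    have e3 : ∫⁻ s, (ENNReal.ofReal (V s) * ψ s) ^ q ∂μ =
        ∫⁻ t in Ioi 0, ENNReal.ofReal (t⁻¹ * A t ^ q) * φ t ^ q := by
      rw [hμ, lintegral_withDensity_eq_lintegral_mul_non_measurable₀ _ hρm
        (Filter.Eventually.of_forall fun x => ENNReal.ofReal_lt_top)]
      refine setLIntegral_congr_fun measurableSet_Ioi fun s hs => ?_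
      have hs : 0 < s := hs
      have hBs := hB.pos s hs
      have hVs := hT.pos s hs
      simp only [Pi.mul_apply, hρ, hψ]
      rw [← mul_assoc (ENNReal.ofReal (V s)), ← ENNReal.ofReal_mul hVs.le,
        ENNReal.mul_rpow_of_nonneg _ _ hq0.le,
        ENNReal.ofReal_rpow_of_nonneg (mul_nonneg hVs.le (by positivity)) hq0.le, ← mul_assoc,
        ← ENNReal.ofReal_mul (by positivity), hA s hs]
      congr 2
      rw [Real.mul_rpow hVs.le (by positivity), Real.mul_rpow (by positivity) hVs.le,
        ← Real.rpow_neg hBs.le, ← Real.rpow_mul hBs.le, ← Real.rpow_mul hBs.le]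
      have : B s ^ (-(q - 1) * q) = B s ^ q * B s ^ (-q * q) := by
        rw [← Real.rpow_add hBs]; ring_nf
      rw [this]
      ring
    have := hardy ψ (hψm.mono_ac (withDensity_absolutelyContinuous _ _))
    simp only [e1] at this
    rwa [e2, e3] at this
  have hQle : weightedNorm 0 q B Q ≤
      ENNReal.ofReal C₂ ^ (1 / q) * ENNReal.ofReal c⁻¹ * weightedNorm 0 q A φ := by
    have h1 : weightedNorm 0 q B Q ≤ ENNReal.ofReal C₂ ^ (1 / q) * weightedNorm 0 q B φ := by
      rw [weightedNorm_eq hq hB.pos, weightedNorm_eq hq hB.pos,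
        ← ENNReal.mul_rpow_of_nonneg _ _ (by positivity)]
      gcongr ?_ ^ _
      refine le_trans (le_of_eq ?_) (hardy' φ hφm)
      refine setLIntegral_congr_fun measurableSet_Ioi fun t ht => ?_
      have ht : 0 < t := ht
      simp only [hQ]
      rw [← lintegral_const_mul' _ _ ENNReal.ofReal_ne_top]
      congr 3
      ext s
      rw [← mul_assoc, ← ENNReal.ofReal_mul ht.le]
      ring_nf
    have h2 : weightedNorm 0 q B φ ≤ ENNReal.ofReal c⁻¹ * weightedNorm 0 q A φ := by
      rw [weightedNorm_eq hq hB.pos, weightedNorm_eq hq hApos]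
      have : ENNReal.ofReal c⁻¹ = (ENNReal.ofReal c⁻¹ ^ q) ^ (1 / q) := by
        rw [← ENNReal.rpow_mul, mul_one_div_cancel hq0.ne', ENNReal.rpow_one]
      rw [this, ← ENNReal.mul_rpow_of_nonneg _ _ (by positivity),
        ENNReal.ofReal_rpow_of_nonneg (by positivity) hq0.le,
        ← lintegral_const_mul' _ _ ENNReal.ofReal_ne_top]
      gcongr ?_ ^ _
      refine setLIntegral_mono' measurableSet_Ioi fun t ht => ?_
      have ht : 0 < t := ht
      rw [← mul_assoc, ← ENNReal.ofReal_mul (by positivity)]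
      gcongr ENNReal.ofReal ?_ * _
      have hBt := hB.pos t ht
      have hAt := hApos t ht
      calc t⁻¹ * B t ^ q ≤ t⁻¹ * (c⁻¹ * A t) ^ q := by gcongr; exact hBA t ht
        _ = _ := by rw [Real.mul_rpow (by positivity) hAt.le]; ring
    calc weightedNorm 0 q B Q ≤ ENNReal.ofReal C₂ ^ (1 / q) * weightedNorm 0 q B φ := h1
      _ ≤ ENNReal.ofReal C₂ ^ (1 / q) * (ENNReal.ofReal c⁻¹ * weightedNorm 0 q A φ) := by gcongr
      _ = _ := (mul_assoc _ _ _).symm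
  calc C.normK 0 q B f ≤ weightedNorm 0 q B (P + Q) := weightedNorm_mono hq fun t ht => hu.K_le ht
    _ ≤ weightedNorm 0 q B P + weightedNorm 0 q B Q := weightedNorm_add_le hq hB.measurable hPm hQm
    _ ≤ M * weightedNorm 0 q A φ := by rw [hM, add_mul]; gcongr

end CompatibleCouple

/-! ### Halving the tail function -/

namespace IsSlowlyVarying

variable {B : ℝ → ℝ} {q : ℝ}

theorem integrableOn_Ioi (hB : IsSlowlyVarying B) (hq : 1 ≤ q)
    (hfin : ∫⁻ s in Ioi (1 : ℝ), ENNReal.ofReal (s⁻¹ * B s ^ q) < ∞) {t : ℝ} (ht : 0 < t) :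
    IntegrableOn (fun s => s⁻¹ * B s ^ q) (Ioi t) :=
  (hB.ofReal_integral_Ioi ht (hB.setLIntegral_Ioi_lt_top hq hfin ht)).1

theorem integral_Ioc_eq_sub (hB : IsSlowlyVarying B) (hq : 1 ≤ q)
    (hfin : ∫⁻ s in Ioi (1 : ℝ), ENNReal.ofReal (s⁻¹ * B s ^ q) < ∞) {a b : ℝ} (ha : 0 < a)
    (hab : a ≤ b) :
    ∫ s in Ioc a b, s⁻¹ * B s ^ q =
      (∫ s in Ioi a, s⁻¹ * B s ^ q) - ∫ s in Ioi b, s⁻¹ * B s ^ q := by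
  have hi := hB.integrableOn_Ioi hq hfin ha
  rw [eq_sub_iff_add_eq, ← Ioc_union_Ioi_eq_Ioi hab,
    setIntegral_union (Ioc_disjoint_Ioi le_rfl) measurableSet_Ioi
      (hi.mono_set Ioc_subset_Ioi_self) (hi.mono_set (Ioi_subset_Ioi hab))]

theorem exists_integral_Ioi_eq (hB : IsSlowlyVarying B) (hq : 1 ≤ q)
    (hfin : ∫⁻ s in Ioi (1 : ℝ), ENNReal.ofReal (s⁻¹ * B s ^ q) < ∞) {r : ℝ} (hr0 : 0 < r)
    (hr : r ≤ ∫ s in Ioi (1 : ℝ), s⁻¹ * B s ^ q) :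
    ∃ t, 1 ≤ t ∧ ∫ s in Ioi t, s⁻¹ * B s ^ q = r := by
  set V : ℝ → ℝ := fun t => ∫ s in Ioi t, s⁻¹ * B s ^ q with hV
  have hi := hB.integrableOn_Ioi hq hfin one_pos
  have heq : ∀ t, 1 ≤ t → V t = V 1 - ∫ s in (1 : ℝ)..t, s⁻¹ * B s ^ q := fun t ht => by
    rw [intervalIntegral.integral_of_le ht, hB.integral_Ioc_eq_sub hq hfin one_pos ht,
      sub_sub_cancel]
  have hlim := intervalIntegral_tendsto_integral_Ioi 1 hi Filter.tendsto_id
  have hev : ∀ᶠ t in Filter.atTop, V 1 - r < ∫ s in (1 : ℝ)..t, s⁻¹ * B s ^ q :=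
    hlim.eventually_const_lt (by simp only [hV]; linarith)
  obtain ⟨X, hX, hX1⟩ := (hev.and (Filter.eventually_ge_atTop 1)).exists
  have hcont : ContinuousOn V (Icc 1 X) := by
    have h1 : ContinuousOn (fun t => V 1 - ∫ s in (1 : ℝ)..t, s⁻¹ * B s ^ q) (Icc 1 X) := by
      refine continuousOn_const.sub ?_
      have := intervalIntegral.continuousOn_primitive_interval (μ := volume)
        (f := fun s => s⁻¹ * B s ^ q) (a := 1) (b := X) (by
          rw [uIcc_of_le hX1, integrableOn_Icc_iff_integrableOn_Ioc]
          exact hi.mono_set Ioc_subset_Ioi_self)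
      rwa [uIcc_of_le hX1] at this
    exact h1.congr fun t ht => heq t ht.1
  have hmem : r ∈ Icc (V X) (V 1) := ⟨by rw [heq X hX1]; linarith, hr⟩
  obtain ⟨t, ht, e⟩ := intermediate_value_Icc' hX1 hcont hmem
  exact ⟨t, ht.1, e⟩

/-- Points `1 ≤ T₀ < T₁ < …` between which the tail function halves. -/
theorem exists_seq_halving (hB : IsSlowlyVarying B) (hq : 1 ≤ q)
    (hfin : ∫⁻ s in Ioi (1 : ℝ), ENNReal.ofReal (s⁻¹ * B s ^ q) < ∞) :
    ∃ T : ℕ → ℝ, (∀ k, 1 ≤ T k) ∧ StrictMono T ∧ ∀ k,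
      ∫ s in Ioi (T k), s⁻¹ * B s ^ q = (∫ s in Ioi (1 : ℝ), s⁻¹ * B s ^ q) * 2⁻¹ ^ k := by
  have hT := hB.isTail hq hfin
  have hv := hT.pos 1 one_pos
  have h : ∀ k : ℕ, ∃ t, 1 ≤ t ∧ ∫ s in Ioi t, s⁻¹ * B s ^ q =
      (∫ s in Ioi (1 : ℝ), s⁻¹ * B s ^ q) * 2⁻¹ ^ k := fun k =>
    hB.exists_integral_Ioi_eq hq hfin (mul_pos hv (by positivity))
      (mul_le_of_le_one_right hv.le (pow_le_one₀ (by norm_num) (by norm_num)))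
  choose T hT1 hTV using h
  refine ⟨T, hT1, strictMono_nat_of_lt_succ fun k => ?_, hTV⟩
  by_contra! hle
  have h1 := hT.antitoneOn (show T (k + 1) ∈ Ioi 0 from one_pos.trans_le (hT1 _))
    (show T k ∈ Ioi 0 from one_pos.trans_le (hT1 _)) hle
  simp only [hTV, pow_succ] at h1
  have : 0 < (∫ s in Ioi (1 : ℝ), s⁻¹ * B s ^ q) * 2⁻¹ ^ k := mul_pos hv (by positivity)
  linarith

end IsSlowlyVarying

/-! ### From `K` to `J` -/

/-- Functions given on disjoint sets have a common extension by zero. -/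
theorem exists_glue {α E : Type*} [Zero E] {S : ℕ → Set α}
    (hS : Pairwise (Function.onFun Disjoint S)) (v : ℕ → α → E) :
    ∃ u : α → E, (∀ k, ∀ s ∈ S k, u s = v k s) ∧ ∀ s ∉ ⋃ k, S k, u s = 0 := by
  classical
  refine ⟨fun s => if h : ∃ k, s ∈ S k then v h.choose s else 0, fun k s hs => ?_, fun s hs => ?_⟩
  · have h : ∃ k, s ∈ S k := ⟨k, hs⟩
    have : h.choose = k := by
      by_contra hne
      exact disjoint_left.1 (hS hne) h.choose_spec hs
    simp only [dif_pos h, this]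
  · simp only [mem_iUnion] at hs
    simp only [dif_neg hs]

theorem integrableOn_Ioi_and_integral_eq_of_tendsto_sum {E : Type*} [NormedAddCommGroup E]
    [NormedSpace ℝ E] {F : ℝ → E} {S : ℕ → Set ℝ} (hSm : ∀ k, MeasurableSet (S k))
    (hS : Pairwise (Function.onFun Disjoint S)) (hS0 : ∀ k, S k ⊆ Ioi 0)
    (hF0 : ∀ s ∉ ⋃ k, S k, F s = 0) (hi : ∀ k, IntegrableOn F (S k))
    (hsum : Summable fun k => ∫ s in S k, ‖F s‖) {g : E}
    (hg : Filter.Tendsto (fun n => ∑ k ∈ Finset.range n, ∫ s in S k, F s) Filter.atTop (nhds g)) :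
    IntegrableOn F (Ioi 0) ∧ ∫ s in Ioi (0 : ℝ), F s = g := by
  have hU : IntegrableOn F (⋃ k, S k) := integrableOn_iUnion_of_summable_integral_norm hi hsum
  have hUm : MeasurableSet (⋃ k, S k) := MeasurableSet.iUnion hSm
  refine ⟨?_, ?_⟩
  · have : (⋃ k, S k).indicator F = F := indicator_eq_self.2 fun s hs => by
      by_contra h
      exact hs (hF0 s h)
    have h2 := (integrable_indicator_iff hUm).2 hU
    rw [this] at h2
    exact h2.integrableOn
  · rw [setIntegral_eq_of_subset_of_forall_sdiff_eq_zero measurableSet_Ioi (iUnion_subset hS0)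
      fun s hs => hF0 s hs.2]
    exact tendsto_nhds_unique (hasSum_integral_iUnion hSm hS hU).tendsto_sum_nat hg

namespace CompatibleCouple

variable {X₀ X₁ 𝒳 : Type*}
  [NormedAddCommGroup X₀] [NormedSpace ℝ X₀] [NormedAddCommGroup X₁] [NormedSpace ℝ X₁]
  [AddCommGroup 𝒳] [Module ℝ 𝒳] [TopologicalSpace 𝒳] [IsTopologicalAddGroup 𝒳]
  [ContinuousSMul ℝ 𝒳] [T2Space 𝒳]

theorem J_smul (C : CompatibleCouple X₀ X₁ 𝒳) {a : ℝ} (ha : 0 ≤ a) (p : C.Inter) (t : ℝ) :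
    C.J (a • p) t = ENNReal.ofReal a * C.J p t := by
  rw [J, J, ← ENNReal.ofReal_mul ha, mul_max_of_nonneg _ _ ha]
  simp only [Submodule.coe_smul, Prod.smul_fst, Prod.smul_snd, norm_smul, Real.norm_of_nonneg ha]
  ring_nf

theorem J_zero (C : CompatibleCouple X₀ X₁ 𝒳) (t : ℝ) : C.J 0 t = 0 := by
  simp [J]

/-- If `‖f‖_{0,q,B;K} < ∞`, then `K(f,T_k)/T_k` decays geometrically along points `T_k` between
which the tail function of `B` halves, because slowly varying functions are smaller than powers. -/
theorem exists_K_div_le_geometric (C : CompatibleCouple X₀ X₁ 𝒳) {q : ℝ} (hq : 1 ≤ q)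
    {B : ℝ → ℝ} (hB : IsSlowlyVarying B)
    (hfin : ∫⁻ s in Ioi (1 : ℝ), ENNReal.ofReal (s⁻¹ * B s ^ q) < ∞) {T : ℕ → ℝ}
    (hT1 : ∀ k, 1 ≤ T k) (hTV : ∀ k,
      ∫ s in Ioi (T k), s⁻¹ * B s ^ q = (∫ s in Ioi (1 : ℝ), s⁻¹ * B s ^ q) * 2⁻¹ ^ k)
    {f : C.Sum} (hf : C.normK 0 q B f < ∞) :
    ∃ D : ℝ, ∀ k, (C.K f (T k)).toReal / T k ≤ D * ((2⁻¹ : ℝ) ^ (1 / q)) ^ k := by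
  have hq0 : 0 < q := by linarith
  have hTl := hB.isTail hq hfin
  set V : ℝ → ℝ := fun t => ∫ s in Ioi t, s⁻¹ * B s ^ q with hV
  obtain ⟨c, hc, hcB⟩ := hB.exists_mul_rpow_le_integral hq hfin
  obtain ⟨c', hc', hcB'⟩ := hB.exists_mul_rpow_neg_le (half_pos one_pos)
  set N := (C.normK 0 q B f).toReal with hN
  set a := c ^ (1 / q) * c' with ha
  have ha0 : 0 < a := by positivity
  refine ⟨N * V 1 ^ (1 / q) / a ^ 2, fun k => ?_⟩
  have hTk : 0 < T k := one_pos.trans_le (hT1 k)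
  have hVk : 0 < V (T k) := hTl.pos _ hTk
  set w := V (T k) ^ (1 / q) with hw
  have hw0 : 0 < w := by positivity
  -- `K(f,T_k) V(T_k)^{1/q} ≤ ‖f‖`
  have h1 : (C.K f (T k)).toReal * w ≤ N := by
    have h := C.setLIntegral_mul_K_rpow_le hq hB.pos f hTk
    rw [← (hB.ofReal_integral_Ioi hTk (hB.setLIntegral_Ioi_lt_top hq hfin hTk)).2] at h
    have h' := ENNReal.rpow_le_rpow h (by positivity : 0 ≤ 1 / q)
    rw [ENNReal.mul_rpow_of_nonneg _ _ (by positivity), ← ENNReal.rpow_mul, ← ENNReal.rpow_mul,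
      mul_one_div_cancel hq0.ne', ENNReal.rpow_one, ENNReal.rpow_one,
      ENNReal.ofReal_rpow_of_pos hVk] at h'
    have h2 := ENNReal.toReal_mono hf.ne h'
    rw [ENNReal.toReal_mul, ENNReal.toReal_ofReal hw0.le, mul_comm] at h2
    exact h2
  -- `T_k^{-1/2} ≲ V(T_k)^{1/q}`
  have h2 : a * T k ^ (-(1 / 2) : ℝ) ≤ w := by
    have h3 := hcB' (T k) (hT1 k)
    have hBk := hB.pos _ hTk
    calc a * T k ^ (-(1 / 2) : ℝ) = c ^ (1 / q) * (c' * T k ^ (-(1 / 2) : ℝ)) := by rw [ha]; ring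
      _ ≤ c ^ (1 / q) * B (T k) := by gcongr
      _ = (c * B (T k) ^ q) ^ (1 / q) := by
        rw [Real.mul_rpow hc.le (by positivity), ← Real.rpow_mul hBk.le,
          mul_one_div_cancel hq0.ne', Real.rpow_one]
      _ ≤ w := by rw [hw]; gcongr; exact hcB _ hTk
  have h3 : a ^ 2 * (T k)⁻¹ ≤ w ^ 2 := by
    have h4 : (T k)⁻¹ = (T k ^ (-(1 / 2) : ℝ)) ^ 2 := by
      rw [← Real.rpow_natCast, ← Real.rpow_mul hTk.le, ← Real.rpow_neg_one]
      norm_num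
    rw [h4, ← mul_pow]
    gcongr
  have hN0 : 0 ≤ N := ENNReal.toReal_nonneg
  have hVw : V 1 ^ (1 / q) * ((2⁻¹ : ℝ) ^ (1 / q)) ^ k = w := by
    have hTk : V (T k) = V 1 * 2⁻¹ ^ k := hTV k
    rw [hw, hTk, Real.mul_rpow (hTl.pos 1 one_pos).le (by positivity), ← Real.rpow_natCast,
      ← Real.rpow_natCast, ← Real.rpow_mul (by norm_num), ← Real.rpow_mul (by norm_num),
      mul_comm (1 / q)]
  calc (C.K f (T k)).toReal / T k ≤ N / w * (w ^ 2 / a ^ 2) := by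
        rw [div_eq_mul_inv]
        gcongr
        · rw [le_div_iff₀ hw0]; exact h1
        · rw [le_div_iff₀ (by positivity), mul_comm]; exact h3
    _ = N * w / a ^ 2 := by field_simp
    _ = _ := by rw [← hVw]; ring

/-- For `f` in `(X₀,X₁)_{0,q,B;K}`, nearly optimal decompositions `f = x_k + y_k` at the points
`T_k` give `f - x₁ = ∑ d_k`, `d_k = x_{k+2} - x_{k+1}`. The function `u` spreads `d_k` over
`(T_k, T_{k+1}]` with density `2^{k+1} V(1)⁻¹ B^q`, that is, to the left of the points at which
`d_k` was obtained, so that `J(d_k,s) ≤ 4 K(f,T_{k+2})` there. -/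
theorem exists_represents [CompleteSpace X₀] [CompleteSpace X₁]
    (C : CompatibleCouple X₀ X₁ 𝒳) {q : ℝ} (hq : 1 ≤ q) {A B : ℝ → ℝ} (hB : IsSlowlyVarying B)
    (hfin : ∫⁻ s in Ioi (1 : ℝ), ENNReal.ofReal (s⁻¹ * B s ^ q) < ∞)
    (hA : ∀ x : ℝ, 0 < x → A x = B x ^ (-(q - 1)) * ∫ t in Ioi x, t⁻¹ * B t ^ q) {T : ℕ → ℝ}
    (hT1 : ∀ k, 1 ≤ T k) (hTm : StrictMono T) (hTV : ∀ k,
      ∫ s in Ioi (T k), s⁻¹ * B s ^ q = (∫ s in Ioi (1 : ℝ), s⁻¹ * B s ^ q) * 2⁻¹ ^ k)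
    {f : C.Sum} (hf0 : f ≠ 0) (hf : C.normK 0 q B f < ∞) :
    ∃ (x : X₀) (u : ℝ → C.Inter), ENNReal.ofReal ‖x‖ ≤ 2 * C.K f (T 1) ∧
      C.Represents u (f - C.inl x) ∧
      weightedNorm 0 q A (fun t => C.J (u t) t) ≤ (8 ^ q * 4) ^ (1 / q) * C.normK 0 q B f := by
  have hq0 : 0 < q := by linarith
  have hTl := hB.isTail hq hfin
  set V : ℝ → ℝ := fun t => ∫ s in Ioi t, s⁻¹ * B s ^ q with hV
  have hv := hTl.pos 1 one_pos
  have hTpos : ∀ k, 0 < T k := fun k => one_pos.trans_le (hT1 k)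
  set κ : ℕ → ℝ := fun k => (C.K f (T k)).toReal with hκ
  have hκ0 : ∀ k, 0 ≤ κ k := fun k => ENNReal.toReal_nonneg
  have hκm : Monotone κ := fun j k hjk =>
    ENNReal.toReal_mono (C.K_lt_top f _).ne (C.monotone_K f (hTm.monotone hjk))
  choose x y hxy hle using fun k => C.exists_decomposition_le_two_mul_K hf0 (hT1 k)
  have hx : ∀ k, ‖x k‖ ≤ 2 * κ k := fun k => by
    have := hle k
    have h2 := mul_nonneg (hTpos k).le (norm_nonneg (y k))
    simp only [hκ]; linarith
  have hy : ∀ k, T k * ‖y k‖ ≤ 2 * κ k := fun k => by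
    have := hle k
    have h2 := norm_nonneg (x k)
    simp only [hκ]; linarith
  have hinl : ∀ j k, C.inl (x j - x k) = C.inr (y k - y j) := fun j k => by
    rw [inl_sub, inr_sub, sub_eq_sub_iff_add_eq_add, ← hxy j, add_comm, ← hxy k]
  set d : ℕ → C.Inter := fun k =>
    ⟨(x (k + 2) - x (k + 1), y (k + 1) - y (k + 2)), C.mem_Inter_of_inl_eq_inr (hinl _ _)⟩ with hd
  have hJd : ∀ k s, 0 < s → s ≤ T (k + 1) → C.J (d k) s ≤ 4 * C.K f (T (k + 2)) := by
    intro k s hs hsT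
    rw [← ENNReal.ofReal_toReal (C.K_lt_top f (T (k + 2))).ne,
      ← ENNReal.ofReal_ofNat (n := 4), ← ENNReal.ofReal_mul (by norm_num)]
    apply ENNReal.ofReal_le_ofReal
    have hm := hκm (Nat.le_succ (k + 1))
    refine max_le ?_ ?_
    · have h1 := norm_sub_le (x (k + 2)) (x (k + 1))
      have h2 := hx (k + 1)
      have h3 := hx (k + 2)
      change ‖x (k + 2) - x (k + 1)‖ ≤ 4 * κ (k + 2)
      linarith
    · have h2 := hy (k + 1)
      have h3 := hy (k + 2)
      have hsT' : s ≤ T (k + 2) := hsT.trans (hTm.monotone (Nat.le_succ (k + 1)))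
      have h4 := mul_le_mul_of_nonneg_right hsT (norm_nonneg (y (k + 1)))
      have h5 := mul_le_mul_of_nonneg_right hsT' (norm_nonneg (y (k + 2)))
      have h1 := mul_le_mul_of_nonneg_left (norm_sub_le (y (k + 1)) (y (k + 2))) hs.le
      change s * ‖y (k + 1) - y (k + 2)‖ ≤ 4 * κ (k + 2)
      linarith
  set S : ℕ → Set ℝ := fun k => Ioc (T k) (T (k + 1)) with hS
  have hSd : Pairwise (Function.onFun Disjoint S) := hTm.monotone.pairwise_disjoint_on_Ioc_succ
  have hSm : ∀ k, MeasurableSet (S k) := fun k => measurableSet_Ioc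
  have hS0 : ∀ k, S k ⊆ Ioi 0 := fun k s hs => (hTpos k).trans hs.1
  set c : ℕ → ℝ := fun k => 2 ^ (k + 1) / V 1 with hc
  have hc0 : ∀ k, 0 < c k := fun k => by positivity
  have hSi : ∀ k, IntegrableOn (fun s => s⁻¹ * B s ^ q) (S k) := fun k =>
    (hB.integrableOn_Ioi hq hfin (hTpos k)).mono_set Ioc_subset_Ioi_self
  have hSint : ∀ k, ∫ s in S k, s⁻¹ * B s ^ q = V 1 * 2⁻¹ ^ (k + 1) := fun k => by
    rw [hB.integral_Ioc_eq_sub hq hfin (hTpos k) (hTm.monotone (Nat.le_add_right k 1)), hTV, hTV]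
    ring
  have hSlint : ∀ k, ∫⁻ s in S k, ENNReal.ofReal (s⁻¹ * B s ^ q) =
      ENNReal.ofReal (V 1 * 2⁻¹ ^ (k + 1)) := fun k => by
    rw [← hSint, ofReal_integral_eq_lintegral_ofReal (hSi k)]
    filter_upwards [ae_restrict_mem (hSm k)] with s hs
    have hs0 : 0 < s := hS0 k hs
    have := hB.pos s hs0
    change 0 ≤ s⁻¹ * B s ^ q
    positivity
  have hcS : ∀ k, V 1 * 2⁻¹ ^ (k + 1) * c k = 1 := fun k => by
    simp only [hc, inv_pow]
    field_simp
  obtain ⟨u, huS, hu0⟩ := exists_glue hSd fun k s => (c k * B s ^ q) • d k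
  -- the series `∑ d_k` converges absolutely in `X₀ + X₁`, with sum `f - x₁`
  obtain ⟨D, hD⟩ := C.exists_K_div_le_geometric hq hB hfin hT1 hTV hf
  set r : ℝ := (2⁻¹ : ℝ) ^ (1 / q) with hr
  have hr0 : 0 ≤ r := by positivity
  have hr1 : r < 1 := Real.rpow_lt_one (by norm_num) (by norm_num) (by positivity)
  have hyD : ∀ k, ‖y k‖ ≤ 2 * D * r ^ k := fun k => by
    have h1 : ‖y k‖ ≤ 2 * (κ k / T k) := by
      rw [← mul_div_assoc, le_div_iff₀ (hTpos k), mul_comm]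
      exact hy k
    have h2 := hD k
    linarith
  have hrlim : Filter.Tendsto (fun k : ℕ => 2 * D * r ^ k) Filter.atTop (nhds 0) := by
    simpa using (tendsto_pow_atTop_nhds_zero_of_lt_one hr0 hr1).const_mul (2 * D)
  have hylim : Filter.Tendsto (fun k => C.inr (y k)) Filter.atTop (nhds 0) :=
    squeeze_zero_norm (fun k => (C.norm_inr_le _).trans (hyD k)) hrlim
  have hdsum : Summable fun k => ‖C.inl (d k).1.1‖ := by
    have hg : Summable fun k : ℕ => 2 * D * r ^ k :=
      (summable_geometric_of_lt_one hr0 hr1).mul_left _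
    refine Summable.of_nonneg_of_le (fun k => norm_nonneg _) (fun k => ?_)
      (((summable_nat_add_iff 1).2 hg).add ((summable_nat_add_iff 2).2 hg))
    rw [inl_fst_eq_inr_snd]
    refine (C.norm_inr_le _).trans ((norm_sub_le _ _).trans (add_le_add (hyD _) (hyD _)))
  have hdlim : Filter.Tendsto (fun n => ∑ k ∈ Finset.range n, C.inl (d k).1.1) Filter.atTop
      (nhds (f - C.inl (x 1))) := by
    have e : ∀ n, ∑ k ∈ Finset.range n, C.inl (d k).1.1 =
        f - C.inl (x 1) - C.inr (y (n + 1)) := fun n => by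
      have e1 : ∀ k, C.inl (d k).1.1 = C.inl (x (k + 1 + 1)) - C.inl (x (k + 1)) :=
        fun k => C.inl_sub _ _
      simp only [e1]
      rw [Finset.sum_range_sub (fun k => C.inl (x (k + 1)))]
      conv_rhs => rw [hxy (n + 1)]
      rw [zero_add]
      abel
    simp only [e]
    simpa using ((hylim.comp (Filter.tendsto_add_atTop_nat 1)).const_sub (f - C.inl (x 1)))
  have hFS : ∀ k, ∀ s ∈ S k, s⁻¹ • C.inl (u s).1.1 = (s⁻¹ * B s ^ q) • c k • C.inl (d k).1.1 := by
    intro k s hs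
    rw [huS k s hs, Submodule.coe_smul, Prod.smul_fst, ← inlL_apply, map_smul, inlL_apply,
      smul_smul, smul_smul]
    congr 1
    ring
  obtain ⟨hint, hval⟩ := integrableOn_Ioi_and_integral_eq_of_tendsto_sum
    (F := fun s => s⁻¹ • C.inl (u s).1.1) hSm hSd hS0
    (fun s hs => by simp [hu0 s hs, inl_zero])
    (fun k => (integrableOn_congr_fun (hFS k) (hSm k)).2 ((hSi k).smul_const _))
    (by
      refine hdsum.congr fun k => ?_
      have : ∀ s ∈ S k, ‖s⁻¹ • C.inl (u s).1.1‖ =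
          (s⁻¹ * B s ^ q) * (c k * ‖C.inl (d k).1.1‖) := fun s hs => by
        have hs0 : 0 < s := hS0 k hs
        have := hB.pos s hs0
        rw [hFS k s hs, norm_smul, norm_smul, Real.norm_of_nonneg (by positivity),
          Real.norm_of_nonneg (hc0 k).le]
      rw [setIntegral_congr_fun (hSm k) this, integral_mul_const, hSint, ← mul_assoc, hcS, one_mul])
    (g := f - C.inl (x 1))
    (by
      refine hdlim.congr fun n => Finset.sum_congr rfl fun k _ => ?_
      rw [setIntegral_congr_fun (hSm k) (hFS k), integral_smul_const, hSint, smul_smul, hcS,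
        one_smul])
  refine ⟨x 1, u, ?_, ⟨?_, hint, hval⟩, ?_⟩
  · rw [← ENNReal.ofReal_toReal (C.K_lt_top f (T 1)).ne, ← ENNReal.ofReal_ofNat (n := 2),
      ← ENNReal.ofReal_mul (by norm_num)]
    exact ENNReal.ofReal_le_ofReal (hx 1)
  · have hU : (⋃ k, S k).indicator u = u := indicator_eq_self.2 fun s hs => by
      by_contra h
      exact hs (hu0 s h)
    rw [← hU]
    refine AEStronglyMeasurable.restrict ?_
    rw [aestronglyMeasurable_indicator_iff (MeasurableSet.iUnion hSm),
      aestronglyMeasurable_iUnion_iff]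
    intro k
    have hm : AEStronglyMeasurable (fun s => (c k * B s ^ q) • d k) (volume.restrict (S k)) := by
      have h1 : AEMeasurable (fun s => c k * B s ^ q) (volume.restrict (S k)) :=
        ((hB.measurable.pow_const q).const_mul (c k)).mono_measure
          (Measure.restrict_mono (hS0 k) le_rfl)
      exact h1.aestronglyMeasurable.smul_const (d k)
    refine hm.congr ?_
    filter_upwards [ae_restrict_mem (hSm k)] with s hs using (huS k s hs).symm
  · have hApos : ∀ t, 0 < t → 0 < A t := fun t ht => by
      rw [hA t ht]
      exact mul_pos (Real.rpow_pos_of_pos (hB.pos t ht) _) (hTl.pos t ht)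
    rw [normK, weightedNorm_eq hq hApos, weightedNorm_eq hq hB.pos,
      ← ENNReal.mul_rpow_of_nonneg _ _ (by positivity)]
    refine ENNReal.rpow_le_rpow ?_ (by positivity)
    set F : ℝ → ℝ≥0∞ := fun t => ENNReal.ofReal (t⁻¹ * A t ^ q) * C.J (u t) t ^ q with hF
    set G : ℝ → ℝ≥0∞ := fun t => ENNReal.ofReal (t⁻¹ * B t ^ q) * C.K f t ^ q with hG
    have hFsub : ∫⁻ t in Ioi (0 : ℝ), F t ≤ ∫⁻ t in ⋃ k, S k, F t := by
      rw [← lintegral_indicator measurableSet_Ioi, ← lintegral_indicator (MeasurableSet.iUnion hSm)]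
      refine lintegral_mono fun t => ?_
      by_cases ht : t ∈ ⋃ k, S k
      · rw [indicator_of_mem ht]
        exact indicator_le_self _ _ _
      · rw [indicator_of_notMem ht]
        have : F t = 0 := by simp [hF, hu0 t ht, J_zero, hq0]
        simp [indicator, this]
    have hFS : ∀ k, ∫⁻ t in S k, F t ≤ 8 ^ q * 4 * ∫⁻ t in S (k + 2), G t := by
      intro k
      have h1 : ∀ t ∈ S k, F t ≤ ENNReal.ofReal (t⁻¹ * B t ^ q) *
          (8 * C.K f (T (k + 2))) ^ q := by
        intro t ht
        have ht0 : 0 < t := hS0 k ht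
        have hBt := hB.pos t ht0
        have hVt := hTl.pos t ht0
        have hVc : V t * c k ≤ 2 := by
          have hle : V t ≤ V 1 * 2⁻¹ ^ k :=
            (hTl.antitoneOn (hTpos k) ht0 ht.1.le).trans_eq (hTV k)
          refine (mul_le_mul_of_nonneg_right hle (hc0 k).le).trans_eq ?_
          simp only [hc, inv_pow]
          field_simp
          ring
        have hAc : A t * (c k * B t ^ q) ≤ 2 * B t := by
          have e : B t ^ (-(q - 1)) * B t ^ q = B t := by
            rw [← Real.rpow_add hBt, neg_sub, sub_add_cancel, Real.rpow_one]
          calc A t * (c k * B t ^ q) = (V t * c k) * (B t ^ (-(q - 1)) * B t ^ q) := by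
                rw [hA t ht0]; ring
            _ ≤ 2 * B t := by rw [e]; gcongr
        have hAt := hApos t ht0
        have hck := hc0 k
        calc F t = ENNReal.ofReal (t⁻¹ * A t ^ q) *
              (ENNReal.ofReal (c k * B t ^ q) * C.J (d k) t) ^ q := by
              simp only [hF]
              rw [huS k t ht, C.J_smul (by positivity)]
          _ = ENNReal.ofReal (t⁻¹ * (A t * (c k * B t ^ q)) ^ q) * C.J (d k) t ^ q := by
              rw [ENNReal.mul_rpow_of_nonneg _ _ hq0.le,
                ENNReal.ofReal_rpow_of_nonneg (by positivity) hq0.le, ← mul_assoc,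
                ← ENNReal.ofReal_mul (by positivity), Real.mul_rpow hAt.le (by positivity),
                mul_assoc]
          _ ≤ ENNReal.ofReal (t⁻¹ * (2 * B t) ^ q) * (4 * C.K f (T (k + 2))) ^ q := by
              gcongr
              exact hJd k t ht0 ht.2
          _ = ENNReal.ofReal (t⁻¹ * B t ^ q) * (8 * C.K f (T (k + 2))) ^ q := by
              have e8 : (8 : ℝ≥0∞) * C.K f (T (k + 2)) =
                  ENNReal.ofReal 2 * (4 * C.K f (T (k + 2))) := by
                rw [← mul_assoc]
                norm_num
              rw [e8, ENNReal.mul_rpow_of_nonneg (ENNReal.ofReal 2) _ hq0.le,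
                ENNReal.ofReal_rpow_of_nonneg zero_le_two hq0.le, ← mul_assoc,
                ← ENNReal.ofReal_mul (by positivity), Real.mul_rpow zero_le_two hBt.le]
              congr 2
              ring
      -- the measures of `S k` and `S (k + 2)` differ by the factor `4`
      have h2 : ENNReal.ofReal (V 1 * 2⁻¹ ^ (k + 1)) =
          4 * ∫⁻ t in S (k + 2), ENNReal.ofReal (t⁻¹ * B t ^ q) := by
        rw [hSlint, ← ENNReal.ofReal_ofNat (n := 4), ← ENNReal.ofReal_mul (by norm_num)]
        congr 1
        ring
      have hKtop : C.K f (T (k + 2)) ^ q ≠ ∞ :=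
        ENNReal.rpow_ne_top_of_nonneg hq0.le (C.K_lt_top f _).ne
      calc ∫⁻ t in S k, F t
          ≤ ∫⁻ t in S k, ENNReal.ofReal (t⁻¹ * B t ^ q) * (8 * C.K f (T (k + 2))) ^ q :=
            setLIntegral_mono' (hSm k) h1
        _ = 4 * (∫⁻ t in S (k + 2), ENNReal.ofReal (t⁻¹ * B t ^ q)) *
              (8 * C.K f (T (k + 2))) ^ q := by
            rw [lintegral_mul_const' _ _ (ENNReal.rpow_ne_top_of_nonneg hq0.le
              (ENNReal.mul_ne_top (by norm_num) (C.K_lt_top f _).ne)), hSlint, h2]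
        _ = 8 ^ q * 4 * ∫⁻ t in S (k + 2), ENNReal.ofReal (t⁻¹ * B t ^ q) *
              C.K f (T (k + 2)) ^ q := by
            rw [lintegral_mul_const' _ _ hKtop, ENNReal.mul_rpow_of_nonneg _ _ hq0.le]
            ring
        _ ≤ 8 ^ q * 4 * ∫⁻ t in S (k + 2), G t := by
            refine mul_le_mul_right (setLIntegral_mono' (hSm _) fun t ht => ?_) _
            simp only [hG]
            gcongr
            exact C.monotone_K f ht.1.le
    calc ∫⁻ t in Ioi (0 : ℝ), F t ≤ ∫⁻ t in ⋃ k, S k, F t := hFsub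
      _ ≤ ∑' k, ∫⁻ t in S k, F t := lintegral_iUnion_le _ _
      _ ≤ ∑' k, 8 ^ q * 4 * ∫⁻ t in S (k + 2), G t := ENNReal.tsum_le_tsum hFS
      _ = 8 ^ q * 4 * ∫⁻ t in ⋃ k, S (k + 2), G t := by
          rw [ENNReal.tsum_mul_left, lintegral_iUnion (s := fun k => S (k + 2)) (fun k => hSm _)
            fun i j hij => hSd (by simpa using hij)]
      _ ≤ 8 ^ q * 4 * ∫⁻ t in Ioi (0 : ℝ), G t := by
          gcongr
          exact iUnion_subset fun k => hS0 _

/-- `(X₀,X₁)_{0,q,B;K} ⊆ X₀ + (X₀,X₁)_{0,q,A;J}`. -/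
theorem exists_sumNorm_normJ_le_mul_normK [CompleteSpace X₀] [CompleteSpace X₁]
    (C : CompatibleCouple X₀ X₁ 𝒳) {q : ℝ} (hq : 1 ≤ q) {A B : ℝ → ℝ} (hB : IsSlowlyVarying B)
    (hfin : ∫⁻ s in Ioi (1 : ℝ), ENNReal.ofReal (s⁻¹ * B s ^ q) < ∞)
    (hA : ∀ x : ℝ, 0 < x → A x = B x ^ (-(q - 1)) * ∫ t in Ioi x, t⁻¹ * B t ^ q) :
    ∃ M : ℝ≥0, ∀ f, sumNorm C.norm₀ (C.normJ 0 q A) f ≤ M * C.normK 0 q B f := by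
  have hq0 : 0 < q := by linarith
  obtain ⟨T, hT1, hTm, hTV⟩ := hB.exists_seq_halving hq hfin
  have hT : 0 < T 1 := one_pos.trans_le (hT1 1)
  set m := ∫⁻ s in Ioi (T 1), ENNReal.ofReal (s⁻¹ * B s ^ q) with hm
  have hm0 : m ≠ 0 := (hB.setLIntegral_Ioi_pos hq hT).ne'
  have hmtop : m ≠ ∞ := (hB.setLIntegral_Ioi_lt_top hq hfin hT).ne
  have h8 : ((8 : ℝ≥0∞) ^ q * 4) ^ (1 / q) ≠ ∞ := ENNReal.rpow_ne_top_of_nonneg (by positivity)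
    (ENNReal.mul_ne_top (ENNReal.rpow_ne_top_of_nonneg hq0.le (by norm_num)) (by norm_num))
  set M : ℝ≥0∞ := 2 * (m⁻¹) ^ (1 / q) + (8 ^ q * 4) ^ (1 / q) + 1 with hM
  have hMtop : M ≠ ∞ := by
    simp only [hM, ne_eq, ENNReal.add_eq_top, not_or]
    exact ⟨⟨ENNReal.mul_ne_top (by norm_num) (ENNReal.rpow_ne_top_of_nonneg (by positivity)
      (ENNReal.inv_ne_top.2 hm0)), h8⟩, ENNReal.one_ne_top⟩
  have hM0 : M ≠ 0 := by simp [hM]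
  refine ⟨M.toNNReal, fun f => ?_⟩
  rw [ENNReal.coe_toNNReal hMtop]
  rcases eq_or_ne (C.normK 0 q B f) ∞ with htop | htop
  · simp [htop, ENNReal.mul_top hM0]
  rcases eq_or_ne f 0 with rfl | hf0
  · have h0 : C.norm₀ 0 ≤ 0 := by simpa [inl_zero] using C.norm₀_inl_le 0
    have h1 : C.normJ 0 q A 0 ≤ 0 := by
      refine iInf_le_of_le (fun _ => 0) (iInf_le_of_le
        ⟨aestronglyMeasurable_const, by
            simp only [Submodule.coe_zero, Prod.fst_zero, inl_zero, smul_zero]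
            exact (integrable_zero ℝ C.Sum volume).integrableOn,
          by simp [inl_zero]⟩ ?_)
      simp [weightedNorm, J_zero, hq0]
    refine (sumNorm_le _ _ (add_zero (0 : C.Sum)).symm).trans ((add_le_add h0 h1).trans ?_)
    simp
  obtain ⟨x, u, hx, hu, hJ⟩ := C.exists_represents hq hB hfin hA hT1 hTm hTV hf0 htop.lt_top
  refine (sumNorm_le _ _ (add_sub_cancel (C.inl x) f).symm).trans ?_
  calc C.norm₀ (C.inl x) + C.normJ 0 q A (f - C.inl x)
      ≤ 2 * ((m⁻¹) ^ (1 / q) * C.normK 0 q B f) +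
          (8 ^ q * 4) ^ (1 / q) * C.normK 0 q B f := by
        gcongr
        · refine (C.norm₀_inl_le x).trans (hx.trans ?_)
          gcongr
          exact C.K_le_mul_normK hq hB.pos f hT hm0 hmtop
        · exact (iInf_le_of_le u (iInf_le _ hu)).trans hJ
    _ ≤ M * C.normK 0 q B f := by
        rw [hM, add_mul, add_mul, mul_assoc]
        exact le_self_add

end CompatibleCouple

/-! ### The two identities -/

theorem sumNorm_le_mul_sumNorm {E : Type*} [AddCommGroup E] {N M M' : E → ℝ≥0∞}
    (hN : ∀ f g, N (f + g) ≤ N f + N g) {C : ℝ≥0} (h : ∀ f, sumNorm N M' f ≤ C * M f) (f : E) :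
    sumNorm N M' f ≤ (C + 1 : ℝ≥0) * sumNorm N M f := by
  have h0 : ((C + 1 : ℝ≥0) : ℝ≥0∞) ≠ 0 := by simp
  rw [← ENNReal.inv_mul_le_iff h0 ENNReal.coe_ne_top]
  refine le_sumNorm fun g k e => ?_
  rw [ENNReal.inv_mul_le_iff h0 ENNReal.coe_ne_top]
  have h1 : sumNorm N M' f ≤ N g + sumNorm N M' k := by
    rw [← tsub_le_iff_left]
    refine le_sumNorm fun g' k' e' => ?_
    rw [tsub_le_iff_left, ← add_assoc]
    exact (sumNorm_le N M' (by rw [e, e', add_assoc])).trans (add_le_add_left (hN g g') _)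
  calc sumNorm N M' f ≤ N g + C * M k := h1.trans (add_le_add_right (h k) _)
    _ ≤ (C + 1 : ℝ≥0) * N g + (C + 1 : ℝ≥0) * M k := by
        gcongr
        · exact le_mul_of_one_le_left' (by simp)
        · simp
    _ = (C + 1 : ℝ≥0) * (N g + M k) := (mul_add _ _ _).symm

theorem sumNorm_le_mul_sumNorm_of_le {E : Type*} [AddCommGroup E] {N M M' : E → ℝ≥0∞}
    {C : ℝ≥0} (h : ∀ f, M' f ≤ C * M f) (f : E) :
    sumNorm N M' f ≤ (C + 1 : ℝ≥0) * sumNorm N M f := by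
  have h0 : ((C + 1 : ℝ≥0) : ℝ≥0∞) ≠ 0 := by simp
  rw [← ENNReal.inv_mul_le_iff h0 ENNReal.coe_ne_top]
  refine le_sumNorm fun g k e => ?_
  rw [ENNReal.inv_mul_le_iff h0 ENNReal.coe_ne_top, mul_add]
  refine (sumNorm_le N M' e).trans (add_le_add ?_ ?_)
  · exact le_mul_of_one_le_left' (by simp)
  · exact (h k).trans (by gcongr; simp)

theorem corollary1p10 {X₀ X₁ 𝒳 : Type*}
    [NormedAddCommGroup X₀] [NormedSpace ℝ X₀] [CompleteSpace X₀]
    [NormedAddCommGroup X₁] [NormedSpace ℝ X₁] [CompleteSpace X₁]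
    [AddCommGroup 𝒳] [Module ℝ 𝒳] [TopologicalSpace 𝒳] [IsTopologicalAddGroup 𝒳]
    [ContinuousSMul ℝ 𝒳] [T2Space 𝒳]
    (X : CompatibleCouple X₀ X₁ 𝒳) (q : ℝ) (hq : 1 ≤ q)
    (b β B A : ℝ → ℝ)
    (hb : IsSlowlyVarying b)
    (hb_fin : ∫⁻ t in Ioi (0 : ℝ), ENNReal.ofReal (t⁻¹ * b t ^ q) < ∞)
    (hβ : IsSlowlyVarying β)
    (hβ_fin : ∀ x : ℝ, 0 < x → ∫⁻ t in Ioi x, ENNReal.ofReal (t⁻¹ * β t ^ q) < ∞)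
    (hβ_inf : ∫⁻ t in Ioi (0 : ℝ), ENNReal.ofReal (t⁻¹ * β t ^ q) = ∞)
    (hB : IsSlowlyVarying B)
    (hBb : ∀ x : ℝ, 1 ≤ x → B x = b x)
    (hBβ : EquivalentOn (Ioo 0 1) B β)
    -- the exponent is `-q/q' = -(q - 1)`, where `1/q + 1/q' = 1`; it is `0` if `q = 1`
    (hA : ∀ x : ℝ, 0 < x → A x = B x ^ (-(q - 1)) * ∫ t in Ioi x, t⁻¹ * B t ^ q) :
    SpacesCoincide (X.normK 0 q b) (sumNorm X.norm₀ (X.normK 0 q B)) ∧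
      SpacesCoincide (sumNorm X.norm₀ (X.normK 0 q B)) (sumNorm X.norm₀ (X.normJ 0 q A)) := by
  have hB_fin : ∫⁻ t in Ioi (1 : ℝ), ENNReal.ofReal (t⁻¹ * B t ^ q) < ∞ := by
    rw [setLIntegral_congr_fun (g := fun t => ENNReal.ofReal (t⁻¹ * b t ^ q)) measurableSet_Ioi
      fun t ht => by rw [hBb t (le_of_lt ht)]]
    exact (lintegral_mono_set (Ioi_subset_Ioi zero_le_one)).trans_lt hb_fin
  obtain ⟨M₁, h₁⟩ := X.exists_normK_le_mul_sumNorm hq hb hB hb_fin hB_fin hBb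
  obtain ⟨M₂, h₂⟩ := X.exists_sumNorm_le_mul_normK hq hb hB hb_fin hBb
  obtain ⟨M₃, h₃⟩ := X.exists_normK_le_mul_normJ hq hB hB_fin hA
  obtain ⟨M₄, h₄⟩ := X.exists_sumNorm_normJ_le_mul_normK hq hB hB_fin hA
  exact ⟨spacesCoincide_of_le h₁ h₂, spacesCoincide_of_le (sumNorm_le_mul_sumNorm_of_le h₃)
    (sumNorm_le_mul_sumNorm X.norm₀_add_le h₄)⟩
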